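/- Fix $0<T<\infty$ and let $(u,v)$ be a solution on $\{0<x<\infty,\ 0<t<T\}$ of the coupled modified NLS equations $$iu_t+u_{xx}+2(|u|^2+|v|^2)u+i[(|u|^2+|v|^2)u]_x=0,\qquad iv_t+v_{xx}+2(|u|^2+|v|^2)v+i[(|u|^2+|v|^2)v]_x=0,$$ with $u,v$ of class $C^2$ on $[0,\infty)\times[0,T]$ and $u(\cdot,t),v(\cdot,t)\in L^1(0,\infty)$ for every $t\in[0,T]$. For $\lambda\in\mathbb C$ put $k=\lambda^2+1$, $\Lambda=\mathrm{diag}(-1,1,1)$, $V_1=\lambda U_1$, $V_2=-2\lambda^3U_1+i\lambda^2U_2-\lambda U_3$, where, with $\rho=|u|^2+|v|^2$, $$U_1=\begin{pmatrix}0&u&v\\u^*&0&0\\v^*&0&0\end{pmatrix},\quad U_2=\begin{pmatrix}-\rho&0&0\\0&|u|^2&u^*v\\0&uv^*&|v|^2\end{pmatrix},\quad U_3=\begin{pmatrix}0&2u+\rho u-iu_x&2v+\rho v-iv_x\\2u^*+\rho u^*+iu_x^*&0&0\\2v^*+\rho v^*+iv_x^*&0&0\end{pmatrix}.$$ The Lax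 pair is $\mu_x+ik[\Lambda,\mu]=V_1\mu$, $\mu_t-2ik^2[\Lambda,\mu]=V_2\mu$. Write $e^{a\hat\Lambda}B=e^{a\Lambda}Be^{-a\Lambda}$. Let $\gamma_1,\gamma_2,\gamma_3$ be the contours ending at $(x,t)$ that run, respectively, from $(0,T)$ through $(0,t)$, from $(0,0)$ through $(0,t)$, and from $(\infty,t)$ horizontally, and for a contour $\gamma$ consider the equation $$\mu(x,t,\lambda)=\mathbb I+\int_{\gamma}e^{(-ik(x-\xi)+2ik^2(t-\tau))\hat\Lambda}(V_1\,d\xi+V_2\,d\tau)\mu(\xi,\tau,\lambda).\qquad(*)$$ Let $l_i$ and $z_i$ be the diagonal entries of $-ik\Lambda$ and $2ik^2\Lambda$, so $l_2=l_3$, $z_2=z_3$, and let $D_1,D_2,D_3,D_4$ be the sets of $\lambda$ where $(\mathrm{Re}\,l_1<\mathrm{Re}\,l_2,\ \mathrm{Re}\,z_1>\mathrm{Re}\,z_2)$, $(<,<)$, $(>,>)$, $(>,<)$ respectively. * $\mu_1$ is the solution of $(*)$ with $\gamma=\gamma_1$, and $S(\lambda)=\mu_1(0,0,\lambda)$. *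 $\mu_3$ is the solution of $(*)$ with $\gamma=\gamma_3$, whose first column is defined for $\lambda\in D_1\cup D_2$ and whose second and third columns are defined for $\lambda\in D_3\cup D_4$; $s(\lambda)=\mu_3(0,0,\lambda)$. * $\mu_3^A$ is the adjugated eigenfunction, the solution of $\mu_3^A=\mathbb I-\int_{\gamma_3}e^{(ik(x-\xi)-2ik^2(t-\tau))\hat\Lambda}(V_1^T\,d\xi+V_2^T\,d\tau)\mu_3^A$, whose first column is defined for $\lambda\in D_3\cup D_4$ and whose second and third columns are defined for $\lambda\in D_1\cup D_2$; $s^A(\lambda)=\mu_3^A(0,0,\lambda)$ and $m_{ij}(s)=(-1)^{i+j}(s^A)_{ij}$. * $M_{ij}(S)$ is the $(i,j)$ minor of $S$ (row $i$ and column $j$ deleted), and $S^A=((-1)^{i+j}M_{ij}(S))_{ij}$ is its cofactor matrix. * For $\lambda\in D_n$, $M_n(\cdot,\cdot,\lambda)$ is a solution of the Lax pair on $[0,\infty)\times[0,T]$ whose $(i,j)$ entry satisfies the $(i,j)$ entry of $(*)$ (convergent integrals) with $\gamma=\gamma^n_{ij}$, where $\gamma_{ij}^n$ is $\gamma_1$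 if $\mathrm{Re}\,l_i<\mathrm{Re}\,l_j$ and $\mathrm{Re}\,z_i\ge\mathrm{Re}\,z_j$, is $\gamma_2$ if $\mathrm{Re}\,l_i<\mathrm{Re}\,l_j$ and $\mathrm{Re}\,z_i<\mathrm{Re}\,z_j$, and is $\gamma_3$ if $\mathrm{Re}\,l_i\ge\mathrm{Re}\,l_j$. **Proposition.** For $n=1,2,3,4$ and every $\lambda\in D_n$ at which $M_n$ exists, the spectral function $S_n(\lambda)=M_n(0,0,\lambda)$ is given by the formula below, where the denominators occurring in it do not vanish at $\lambda$: $$S_1=\begin{pmatrix} s_{11}&\frac{m_{33}(s)M_{21}(S)-m_{23}(s)M_{31}(S)}{(s^TS^A)_{11}}&\frac{m_{32}(s)M_{21}(S)-m_{22}(s)M_{31}(S)}{(s^TS^A)_{11}}\\ s_{21}&\frac{m_{33}(s)M_{11}(S)-m_{13}(s)M_{31}(S)}{(s^TS^A)_{11}}&\frac{m_{32}(s)M_{11}(S)-m_{12}(s)M_{31}(S)}{(s^TS^A)_{11}}\\ s_{31}&\frac{m_{23}(s)M_{11}(S)-m_{13}(s)M_{21}(S)}{(s^TS^A)_{11}}&\frac{m_{22}(s)M_{11}(S)-m_{12}(s)M_{21}(S)}{(s^TS^A)_{11}}\end{pmatrix},$$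 $$S_2=\begin{pmatrix}s_{11}&0&0\\ s_{21}&\frac{m_{33}(s)}{s_{11}}&\frac{m_{32}(s)}{s_{11}}\\ s_{31}&\frac{m_{23}(s)}{s_{11}}&\frac{m_{22}(s)}{s_{11}}\end{pmatrix},\quad S_3=\begin{pmatrix}\frac1{m_{11}(s)}&s_{12}&s_{13}\\0&s_{22}&s_{23}\\0&s_{32}&s_{33}\end{pmatrix},\quad S_4=\begin{pmatrix}\frac{S_{11}}{(S^Ts^A)_{11}}&s_{12}&s_{13}\\ \frac{S_{21}}{(S^Ts^A)_{11}}&s_{22}&s_{23}\\ \frac{S_{31}}{(S^Ts^A)_{11}}&s_{32}&s_{33}\end{pmatrix}.$$ Moreover $s^A$ is the cofactor matrix of $s$ wherever this makes sense: if the $j$-th column of $\mu_3^A$ is defined at $\lambda$ in the above sense and the two columns of $\mu_3$ other than the $j$-th also solve $(*)$ with $\gamma=\gamma_3$ at $\lambda$ (with convergent integrals), then $(s^A)_{ij}(\lambda)=(-1)^{i+j}m_{ij}(s(\lambda))$ for $i=1,2,3$, with $m_{ij}(s(\lambda))$ the actual $(i,j)$ minor. In particular this holds for $j=1$ and all $\lambda\in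 D_3\cup D_4$. -/

import Mathlib

open Set MeasureTheory

noncomputable section

namespace CMNLS

/-! The coupled modified nonlinear Schrödinger equations with parameters `δ = 2`, `γ = 1`, on the
half-strip `0 ≤ x`, `0 ≤ t ≤ T`, and the eigenfunctions of their Lax pair.  Rows and columns of
`3 × 3` matrices are numbered `0, 1, 2`. The spectral parameter is called `lam`. -/

abbrev Mat3 := Matrix (Fin 3) (Fin 3) ℂ

/-- `|u|² + |v|²` -/
def rho (u v : ℝ → ℝ → ℂ) (x t : ℝ) : ℂ :=
  u x t * star (u x t) + v x t * star (v x t)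

/-- `(u, v)` is a solution of
`i u_t + u_xx + 2 (|u|² + |v|²) u + i [(|u|² + |v|²) u]_x = 0` and of the same equation for `v`,
of class `C²` up to the boundary and integrable in `x` on the half-line at each time. -/
structure IsSolution (T : ℝ) (u v : ℝ → ℝ → ℂ) : Prop where
  smooth_u : ContDiffOn ℝ 2 (fun p : ℝ × ℝ => u p.1 p.2) (Ici 0 ×ˢ Icc 0 T)
  smooth_v : ContDiffOn ℝ 2 (fun p : ℝ × ℝ => v p.1 p.2) (Ici 0 ×ˢ Icc 0 T)
  decay_u : ∀ t ∈ Icc 0 T, IntegrableOn (fun x => u x t) (Ioi 0)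
  decay_v : ∀ t ∈ Icc 0 T, IntegrableOn (fun x => v x t) (Ioi 0)
  eq_u : ∀ x ∈ Ioi (0 : ℝ), ∀ t ∈ Ioo 0 T,
    Complex.I * deriv (fun τ => u x τ) t + deriv (fun ξ => deriv (fun η => u η t) ξ) x
      + 2 * (rho u v x t * u x t)
      + Complex.I * deriv (fun ξ => rho u v ξ t * u ξ t) x = 0
  eq_v : ∀ x ∈ Ioi (0 : ℝ), ∀ t ∈ Ioo 0 T,
    Complex.I * deriv (fun τ => v x τ) t + deriv (fun ξ => deriv (fun η => v η t) ξ) x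
      + 2 * (rho u v x t * v x t)
      + Complex.I * deriv (fun ξ => rho u v ξ t * v ξ t) x = 0

/-- The `x`-derivative on the half-line (one-sided at `x = 0`). -/
def dx (u : ℝ → ℝ → ℂ) (x t : ℝ) : ℂ := derivWithin (fun ξ => u ξ t) (Ici 0) x

/-- The diagonal of `Λ`. -/
def lamDiag : Fin 3 → ℂ := ![-1, 1, 1]

def LamMat : Mat3 := Matrix.diagonal lamDiag

/-- `k = λ² + 1` -/
def kk (lam : ℂ) : ℂ := lam ^ 2 + 1

def U1 (u v : ℝ → ℝ → ℂ) (x t : ℝ) : Mat3 :=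
  !![0, u x t, v x t;
     star (u x t), 0, 0;
     star (v x t), 0, 0]

def U2 (u v : ℝ → ℝ → ℂ) (x t : ℝ) : Mat3 :=
  !![-rho u v x t, 0, 0;
     0, u x t * star (u x t), star (u x t) * v x t;
     0, u x t * star (v x t), v x t * star (v x t)]

/-- The upper off-diagonal entries `2 u + (|u|² + |v|²) u - i u_x` of `U₃`
(with `w = u` or `w = v`). -/
def upperA (u v w : ℝ → ℝ → ℂ) (x t : ℝ) : ℂ :=
  2 * w x t + w x t * rho u v x t - Complex.I * dx w x t

/-- The lower off-diagonal entries `2 u* + (|u|² + |v|²) u* + i u*_x` of `U₃`. -/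
def lowerA (u v w : ℝ → ℝ → ℂ) (x t : ℝ) : ℂ :=
  2 * star (w x t) + star (w x t) * rho u v x t + Complex.I * star (dx w x t)

def U3 (u v : ℝ → ℝ → ℂ) (x t : ℝ) : Mat3 :=
  !![0, upperA u v u x t, upperA u v v x t;
     lowerA u v u x t, 0, 0;
     lowerA u v v x t, 0, 0]

def V1 (u v : ℝ → ℝ → ℂ) (lam : ℂ) (x t : ℝ) : Mat3 := lam • U1 u v x t

def V2 (u v : ℝ → ℝ → ℂ) (lam : ℂ) (x t : ℝ) : Mat3 :=
  (-2 * lam ^ 3) • U1 u v x t + (Complex.I * lam ^ 2) • U2 u v x t - lam • U3 u v x t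

/-- `e^{a Λ̂} B = e^{a Λ} B e^{-a Λ}`, where `Λ̂ B = [Λ, B]`. -/
def expHat (a : ℂ) (B : Mat3) : Mat3 :=
  Matrix.diagonal (fun i => Complex.exp (a * lamDiag i)) * B *
    Matrix.diagonal (fun i => Complex.exp (-(a * lamDiag i)))

/-- The Lax pair `μ_x + i k [Λ, μ] = V₁ μ`, `μ_t - 2 i k² [Λ, μ] = V₂ μ`
on the closed half-strip (derivatives one-sided at the boundary). -/
structure SolvesLax (T : ℝ) (u v : ℝ → ℝ → ℂ) (lam : ℂ) (μ : ℝ → ℝ → Mat3) : Prop where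
  x_part : ∀ x ∈ Ici (0 : ℝ), ∀ t ∈ Icc 0 T, ∀ i j,
    HasDerivWithinAt (fun ξ => μ ξ t i j)
      ((V1 u v lam x t * μ x t
        - (Complex.I * kk lam) • (LamMat * μ x t - μ x t * LamMat)) i j) (Ici 0) x
  t_part : ∀ x ∈ Ici (0 : ℝ), ∀ t ∈ Icc 0 T, ∀ i j,
    HasDerivWithinAt (fun τ => μ x τ i j)
      ((V2 u v lam x t * μ x t
        + (2 * Complex.I * kk lam ^ 2) • (LamMat * μ x t - μ x t * LamMat)) i j) (Icc 0 T) t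

/-- The three contours ending at `(x, t)`:
`γ₁` runs from `(0, T)` through `(0, t)`, `γ₂` from `(0, 0)` through `(0, t)`, and
`γ₃` comes horizontally from `(∞, t)`. -/
inductive Contour
  | one
  | two
  | three

/-- The one-form `p dξ + q dτ` is integrable along the contour ending at `(x, t)`. -/
def Contour.FormIntegrable (T : ℝ) (p q : ℝ → ℝ → ℂ) (x t : ℝ) : Contour → Prop
  | .one => IntervalIntegrable (fun τ => q 0 τ) volume T t ∧
      IntervalIntegrable (fun ξ => p ξ t) volume 0 x
  | .two => IntervalIntegrable (fun τ => q 0 τ) volume 0 t ∧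
      IntervalIntegrable (fun ξ => p ξ t) volume 0 x
  | .three => IntegrableOn (fun ξ => p ξ t) (Ioi x)

/-- The integral of the one-form `p dξ + q dτ` along the contour ending at `(x, t)`. -/
def Contour.formIntegral (T : ℝ) (p q : ℝ → ℝ → ℂ) (x t : ℝ) : Contour → ℂ
  | .one => (∫ τ in T..t, q 0 τ) + ∫ ξ in (0 : ℝ)..x, p ξ t
  | .two => (∫ τ in (0 : ℝ)..t, q 0 τ) + ∫ ξ in (0 : ℝ)..x, p ξ t
  | .three => -∫ ξ in Ioi x, p ξ t

/-- The `(i, j)` entry of the integral equation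
`μ(x,t) = I + ∫_c e^{(-i k (x-ξ) + 2 i k² (t-τ)) Λ̂} (V₁ dξ + V₂ dτ) μ`
holds on the closed half-strip.  It involves only the `j`-th column of `μ`. -/
def SolvesEntry (c : Contour) (T : ℝ) (u v : ℝ → ℝ → ℂ) (lam : ℂ) (μ : ℝ → ℝ → Mat3)
    (i j : Fin 3) : Prop :=
  ∀ x ∈ Ici (0 : ℝ), ∀ t ∈ Icc 0 T,
    let a : ℝ → ℝ → ℂ := fun ξ τ =>
      -(Complex.I * kk lam * ((x - ξ : ℝ) : ℂ)) + 2 * Complex.I * kk lam ^ 2 * ((t - τ : ℝ) : ℂ)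
    let p : ℝ → ℝ → ℂ := fun ξ τ => expHat (a ξ τ) (V1 u v lam ξ τ * μ ξ τ) i j
    let q : ℝ → ℝ → ℂ := fun ξ τ => expHat (a ξ τ) (V2 u v lam ξ τ * μ ξ τ) i j
    c.FormIntegrable T p q x t ∧ μ x t i j = (1 : Mat3) i j + c.formIntegral T p q x t

/-- The `(i, j)` entry of the integral equation of the adjugated eigenfunctions,
`μ(x,t) = I - ∫_c e^{(i k (x-ξ) - 2 i k² (t-τ)) Λ̂} (V₁ᵀ dξ + V₂ᵀ dτ) μ`. -/
def SolvesAdjEntry (c : Contour) (T : ℝ) (u v : ℝ → ℝ → ℂ) (lam : ℂ) (μ : ℝ → ℝ → Mat3)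
    (i j : Fin 3) : Prop :=
  ∀ x ∈ Ici (0 : ℝ), ∀ t ∈ Icc 0 T,
    let a : ℝ → ℝ → ℂ := fun ξ τ =>
      Complex.I * kk lam * ((x - ξ : ℝ) : ℂ) - 2 * Complex.I * kk lam ^ 2 * ((t - τ : ℝ) : ℂ)
    let p : ℝ → ℝ → ℂ := fun ξ τ =>
      expHat (a ξ τ) ((V1 u v lam ξ τ).transpose * μ ξ τ) i j
    let q : ℝ → ℝ → ℂ := fun ξ τ =>
      expHat (a ξ τ) ((V2 u v lam ξ τ).transpose * μ ξ τ) i j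
    c.FormIntegrable T p q x t ∧ μ x t i j = (1 : Mat3) i j - c.formIntegral T p q x t

/-- The diagonal entries of `-i k Λ`. -/
def ll (lam : ℂ) (i : Fin 3) : ℂ := -(Complex.I * kk lam * lamDiag i)

/-- The diagonal entries of `2 i k² Λ`. -/
def zz (lam : ℂ) (i : Fin 3) : ℂ := 2 * Complex.I * kk lam ^ 2 * lamDiag i

def D1 : Set ℂ := {lam | (ll lam 0).re < (ll lam 1).re ∧ (ll lam 1).re = (ll lam 2).re ∧
  (zz lam 0).re > (zz lam 1).re ∧ (zz lam 1).re = (zz lam 2).re}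

def D2 : Set ℂ := {lam | (ll lam 0).re < (ll lam 1).re ∧ (ll lam 1).re = (ll lam 2).re ∧
  (zz lam 0).re < (zz lam 1).re ∧ (zz lam 1).re = (zz lam 2).re}

def D3 : Set ℂ := {lam | (ll lam 0).re > (ll lam 1).re ∧ (ll lam 1).re = (ll lam 2).re ∧
  (zz lam 0).re > (zz lam 1).re ∧ (zz lam 1).re = (zz lam 2).re}

def D4 : Set ℂ := {lam | (ll lam 0).re > (ll lam 1).re ∧ (ll lam 1).re = (ll lam 2).re ∧
  (zz lam 0).re < (zz lam 1).re ∧ (zz lam 1).re = (zz lam 2).re}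

/-- The set of `λ` for which the `j`-th column of `μ₃` is defined:
`(D₁ ∪ D₂, D₃ ∪ D₄, D₃ ∪ D₄)`. -/
def mu3Domain : Fin 3 → Set ℂ := ![D1 ∪ D2, D3 ∪ D4, D3 ∪ D4]

/-- The set of `λ` for which the `j`-th column of the adjugated eigenfunction `μ₃ᴬ` is defined:
`(D₃ ∪ D₄, D₁ ∪ D₂, D₁ ∪ D₂)`. -/
def mu3AdjDomain : Fin 3 → Set ℂ := ![D3 ∪ D4, D1 ∪ D2, D1 ∪ D2]

open Classical in
/-- The contour `γ_{ij}ⁿ` for `λ ∈ D_n`. -/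
def contourOf (lam : ℂ) (i j : Fin 3) : Contour :=
  if (ll lam i).re < (ll lam j).re then
    if (zz lam i).re ≥ (zz lam j).re then Contour.one else Contour.two
  else Contour.three

/-- `μ₁(x,t,λ)`: the solution of the integral equation along `γ₁`. -/
def IsMu1 (T : ℝ) (u v : ℝ → ℝ → ℂ) (μ : ℝ → ℝ → ℂ → Mat3) : Prop :=
  ∀ lam : ℂ, ∀ i j, SolvesEntry Contour.one T u v lam (fun x t => μ x t lam) i j

/-- `μ₃(x,t,λ)`: each column solves the integral equation along `γ₃` for the `λ` for which
that column is defined; elsewhere the column is arbitrary. -/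
def IsMu3 (T : ℝ) (u v : ℝ → ℝ → ℂ) (μ : ℝ → ℝ → ℂ → Mat3) : Prop :=
  ∀ j, ∀ lam ∈ mu3Domain j, ∀ i,
    SolvesEntry Contour.three T u v lam (fun x t => μ x t lam) i j

/-- The adjugated eigenfunction `μ₃ᴬ(x,t,λ)`, column by column as for `μ₃`. -/
def IsMu3Adj (T : ℝ) (u v : ℝ → ℝ → ℂ) (μ : ℝ → ℝ → ℂ → Mat3) : Prop :=
  ∀ j, ∀ lam ∈ mu3AdjDomain j, ∀ i,
    SolvesAdjEntry Contour.three T u v lam (fun x t => μ x t lam) i j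

/-- `M` is the eigenfunction `M_n(·,·,λ)`, where `λ ∈ D_n`: a solution of the Lax pair whose
`(i, j)` entry satisfies the integral equation along `γ_{ij}ⁿ`. -/
structure IsM (T : ℝ) (u v : ℝ → ℝ → ℂ) (lam : ℂ) (M : ℝ → ℝ → Mat3) : Prop where
  lax : SolvesLax T u v lam M
  entries : ∀ i j, SolvesEntry (contourOf lam i j) T u v lam M i j

/-- The `(i, j)` minor: the determinant with row `i` and column `j` deleted. -/
def minor (B : Mat3) (i j : Fin 3) : ℂ := (B.submatrix i.succAbove j.succAbove).det

/-- The cofactor matrix `Bᴬ`. -/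
def cofactor (B : Mat3) : Mat3 :=
  Matrix.of fun i j => (-1) ^ ((i : ℕ) + (j : ℕ)) * minor B i j

/-- The minor `m_{ij}` read off from a cofactor matrix. -/
def minorOfCofactor (A : Mat3) (i j : Fin 3) : ℂ := (-1) ^ ((i : ℕ) + (j : ℕ)) * A i j

/-- `(sᵀ Sᴬ)₁₁` -/
def den1 (s S : Mat3) : ℂ := (s.transpose * cofactor S) 0 0

/-- `(Sᵀ sᴬ)₁₁` -/
def den4 (sA S : Mat3) : ℂ := (S.transpose * sA) 0 0

/-- The formula for `S₁` in terms of `s`, `sᴬ` and `S`. -/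
def formula1 (s sA S : Mat3) : Mat3 :=
  let m := minorOfCofactor sA
  let N := minor S
  let d := den1 s S
  !![s 0 0, (m 2 2 * N 1 0 - m 1 2 * N 2 0) / d, (m 2 1 * N 1 0 - m 1 1 * N 2 0) / d;
     s 1 0, (m 2 2 * N 0 0 - m 0 2 * N 2 0) / d, (m 2 1 * N 0 0 - m 0 1 * N 2 0) / d;
     s 2 0, (m 1 2 * N 0 0 - m 0 2 * N 1 0) / d, (m 1 1 * N 0 0 - m 0 1 * N 1 0) / d]

/-- The formula for `S₂`. -/
def formula2 (s sA : Mat3) : Mat3 :=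
  let m := minorOfCofactor sA
  !![s 0 0, 0, 0;
     s 1 0, m 2 2 / s 0 0, m 2 1 / s 0 0;
     s 2 0, m 1 2 / s 0 0, m 1 1 / s 0 0]

/-- The formula for `S₃`. -/
def formula3 (s sA : Mat3) : Mat3 :=
  !![1 / minorOfCofactor sA 0 0, s 0 1, s 0 2;
     0, s 1 1, s 1 2;
     0, s 2 1, s 2 2]

/-- The formula for `S₄`. -/
def formula4 (s sA S : Mat3) : Mat3 :=
  let d := den4 sA S
  !![S 0 0 / d, s 0 1, s 0 2;
     S 1 0 / d, s 1 1, s 1 2;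
     S 2 0 / d, s 2 1, s 2 2]

end CMNLS

end

/-! Everything is read off on the two lines `t = 0` and `x = 0`, by means of Wronskians. A column
of `μ₃`, of `M_n` or of `μ₁` solves a linear equation `w' = C w - κ (Λ - λ_m) w` there, with `C`
traceless (`ColumnSolves`). Hence the determinant of any three such columns solves a scalar
equation `f' = r f` (`ColumnSolves.hasDerivWithinAt_det`), and so does the pairing of a column
with a column of the adjugated eigenfunction (`ColumnSolves.hasDerivWithinAt_dotProduct`). Such an
`f` is known from its limit at infinity when `r = 0`, and vanishes when it tends to `0` and `exp
(r x)` does not decay (`eq_of_tendsto_of_hasDerivWithinAt`).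

On `t = 0` every column defined along `γ₃` tends to the corresponding column of the identity
(`TailColumn.tendsto`), and so does all of `M_n` (`IsM.tendsto`). The signs of the phases in `D_n`
then give, with `M = M_n(0,0)`:
* `det M = 1` (`IsM.det_eq_one`);
* the columns of `M` along `γ₃` are those of `s` (`IsM.col_eq_of_tailColumn`);
* the columns of `s^A` that are defined are columns of cofactors of `M`
  (`IsM.cofactor_eq_of_tailColumn`).

On `x = 0` the normalization at `(0, 0)` of the entries along `γ₂` yields zeros of `M`, and that
at `(0, T)` of the entries along `γ₁` is carried to `(0, 0)` by the determinants of columns of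
`M_n` and `μ₁` (`det_updateCol_eq_zero`). These relations determine `M`, and `det M = 1` makes the
denominators nonzero (`eq_formula1`, …, `eq_formula4`).

For the last assertion there is no `M_n`. A column of `μ₃^A` annihilates the two other columns of
`μ₃`, so far out it is a multiple of their cross product; both solve the same linear equation, so
the multiple persists down to the origin, and its factor tends to `1` (`TailColumn.eq_cofactor`).
-/

namespace CMNLS

open Filter Matrix
open scoped Topology

/-! ### Column equations and their Wronskians -/

/-- The column equation `w' = C w - κ (Λ - λ_m) w` on `s`: it is satisfied by the `m`-th column of a
matrix solution of `W' = C W - κ [Λ, W]`. -/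
def ColumnSolves (s : Set ℝ) (C : ℝ → Mat3) (κ : ℂ) (m : Fin 3) (w : ℝ → Fin 3 → ℂ) : Prop :=
  ∀ x ∈ s, ∀ i, HasDerivWithinAt (fun ξ => w ξ i)
    ((C x *ᵥ w x) i - κ * (lamDiag i - lamDiag m) * w x i) s x

/-- A determinant formed from column solutions with labels `m a` satisfies a scalar equation: the
coefficient matrix drops out because it is traceless, and only the phases of the labels remain. -/
theorem ColumnSolves.hasDerivWithinAt_det {s : Set ℝ} {C : ℝ → Mat3} {κ : ℂ} {W : ℝ → Mat3}
    {m : Fin 3 → Fin 3}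
    (hW : ∀ a, ColumnSolves s C κ (m a) (fun x i => W x i a)) (hC : ∀ x ∈ s, (C x).trace = 0) :
    ∀ x ∈ s, HasDerivWithinAt (fun ξ => (W ξ).det)
      (κ * ((∑ a, lamDiag (m a)) - 1) * (W x).det) s x := by
  intro x hx
  have h := fun i a => hW a x hx i
  have htr : C x 0 0 = -(C x 1 1) - C x 2 2 := by
    have := hC x hx
    rw [Matrix.trace_fin_three] at this
    linear_combination this
  simp only [Matrix.det_fin_three]
  refine ((((((((h 0 0).mul (h 1 1)).mul (h 2 2)).sub (((h 0 0).mul (h 1 2)).mul (h 2 1))).sub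
    (((h 0 1).mul (h 1 0)).mul (h 2 2))).add (((h 0 1).mul (h 1 2)).mul (h 2 0))).add
    (((h 0 2).mul (h 1 0)).mul (h 2 1))).sub (((h 0 2).mul (h 1 1)).mul (h 2 0))).congr_deriv ?_
  simp only [Matrix.mulVec, dotProduct, Fin.sum_univ_three, htr, Pi.mul_apply]
  simp only [lamDiag, Matrix.cons_val_zero, Matrix.cons_val_one, Matrix.cons_val]
  ring

/-- The bilinear pairing of a solution of the adjugated equation with a column solution satisfies a
scalar equation. -/
theorem ColumnSolves.hasDerivWithinAt_dotProduct {s : Set ℝ} {C : ℝ → Mat3} {κ : ℂ} {j m : Fin 3}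
    {A w : ℝ → Fin 3 → ℂ} (hA : ColumnSolves s (fun x => -(C x)ᵀ) (-κ) j A)
    (hw : ColumnSolves s C κ m w) :
    ∀ x ∈ s, HasDerivWithinAt (fun ξ => A ξ ⬝ᵥ w ξ)
      (κ * (lamDiag m - lamDiag j) * (A x ⬝ᵥ w x)) s x := by
  intro x hx
  have h := fun i => (hA x hx i).mul (hw x hx i)
  simp only [dotProduct, Fin.sum_univ_three]
  refine (((h 0).add (h 1)).add (h 2)).congr_deriv ?_
  simp only [Matrix.mulVec, dotProduct, Fin.sum_univ_three, Matrix.neg_apply,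
    Matrix.transpose_apply]
  ring

theorem cofactor_eq_transpose_adjugate (B : Mat3) : cofactor B = B.adjugateᵀ := by
  ext i j
  rw [Matrix.transpose_apply, Matrix.adjugate_fin_succ_eq_det_submatrix]
  rfl

theorem cofactor_col_eq_crossProduct (B : Mat3) (j : Fin 3) :
    (fun i => cofactor B i j) =
      crossProduct (fun i => B i (j + 1)) (fun i => B i (j + 2)) := by
  simp only [cofactor_eq_transpose_adjugate, Matrix.adjugate_fin_three, Matrix.transpose_apply,
    cross_apply]
  ext i
  fin_cases j <;> fin_cases i <;> simp <;> ring

/-- The cross product of two column solutions solves the adjugated equation. The label `j` is the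
one left over by `a` and `b`, as expressed by `tr Λ = 1`. -/
theorem ColumnSolves.cross {s : Set ℝ} {C : ℝ → Mat3} {κ : ℂ} {a b j : Fin 3}
    {w z : ℝ → Fin 3 → ℂ} (hw : ColumnSolves s C κ a w) (hz : ColumnSolves s C κ b z)
    (hC : ∀ x ∈ s, (C x).trace = 0) (hj : lamDiag a + lamDiag b = 1 - lamDiag j) :
    ColumnSolves s (fun x => -(C x)ᵀ) (-κ) j
      (fun x => crossProduct (w x) (z x)) := by
  intro x hx
  have htr : C x 0 0 = -(C x 1 1) - C x 2 2 := by
    have := hC x hx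
    rw [Matrix.trace_fin_three] at this
    linear_combination this
  have hE (p q : Fin 3) := ((hw x hx p).mul (hz x hx q)).sub ((hw x hx q).mul (hz x hx p))
  have hb : lamDiag b = 1 - lamDiag j - lamDiag a := by linear_combination hj
  intro i
  simp only [cross_apply]
  fin_cases i
  · refine (hE 1 2).congr_deriv ?_
    simp [Matrix.mulVec, dotProduct, Fin.sum_univ_three, htr, hb,
      show lamDiag 0 = -1 from rfl, show lamDiag 1 = 1 from rfl, show lamDiag 2 = 1 from rfl]
    ring
  · refine (hE 2 0).congr_deriv ?_
    simp [Matrix.mulVec, dotProduct, Fin.sum_univ_three, htr, hb,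
      show lamDiag 0 = -1 from rfl, show lamDiag 1 = 1 from rfl, show lamDiag 2 = 1 from rfl]
    ring
  · refine (hE 0 1).congr_deriv ?_
    simp [Matrix.mulVec, dotProduct, Fin.sum_univ_three, htr, hb,
      show lamDiag 0 = -1 from rfl, show lamDiag 1 = 1 from rfl, show lamDiag 2 = 1 from rfl]
    ring

theorem ColumnSolves.cofactor_col {s : Set ℝ} {C : ℝ → Mat3} {κ : ℂ} {W : ℝ → Mat3}
    {j : Fin 3} (hW : ∀ a ≠ j, ColumnSolves s C κ a (fun x i => W x i a))
    (hC : ∀ x ∈ s, (C x).trace = 0) :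
    ColumnSolves s (fun x => -(C x)ᵀ) (-κ) j (fun x i => cofactor (W x) i j) := by
  rw [show (fun x i => cofactor (W x) i j) = fun x => crossProduct (fun i => W x i (j + 1))
    (fun i => W x i (j + 2)) from funext fun x => cofactor_col_eq_crossProduct (W x) j]
  refine ColumnSolves.cross (hW (j + 1) ?_) (hW (j + 2) ?_) hC ?_
  · fin_cases j <;> decide
  · fin_cases j <;> decide
  · fin_cases j <;> simp [lamDiag]

/-! ### Scalar equations -/

/-- Solutions of `f' = r f` on an interval are multiples of `exp (r x)`. -/
theorem eq_exp_mul_of_hasDerivWithinAt {s : Set ℝ} (hs : Convex ℝ s) {f : ℝ → ℂ} {r : ℂ}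
    (hf : ∀ x ∈ s, HasDerivWithinAt f (r * f x) s x) {x y : ℝ} (hx : x ∈ s) (hy : y ∈ s) :
    f y = Complex.exp (r * (y - x : ℝ)) * f x := by
  have h : ∀ z ∈ s, HasDerivWithinAt (fun ξ : ℝ => Complex.exp (-(r * (ξ : ℂ))) * f ξ) 0 s z := by
    intro z hz
    have he : HasDerivAt (fun ξ : ℝ => Complex.exp (-(r * (ξ : ℂ))))
        (Complex.exp (-(r * (z : ℂ))) * -(r * 1)) z :=
      ((Complex.ofRealCLM.hasDerivAt.const_mul r).neg).cexp
    refine (he.hasDerivWithinAt.mul (hf z hz)).congr_deriv ?_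
    ring
  have h0 := hs.norm_image_sub_le_of_norm_hasDerivWithin_le (C := 0) h (by simp) hx hy
  rw [zero_mul, norm_le_zero_iff, sub_eq_zero] at h0
  calc f y = Complex.exp (r * y) * (Complex.exp (-(r * y)) * f y) := by
        rw [← mul_assoc, ← Complex.exp_add]; simp
    _ = _ := by
        rw [h0, ← mul_assoc, ← Complex.exp_add]
        congr 2
        push_cast
        ring

/-- A solution of `f' = r f` on the half-line with a limit at infinity starts at that limit, if
`r = 0`, or if `exp (r x)` does not decay and the limit is `0`. -/
theorem eq_of_tendsto_of_hasDerivWithinAt {f : ℝ → ℂ} {r L : ℂ}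
    (hf : ∀ x ∈ Ici (0 : ℝ), HasDerivWithinAt f (r * f x) (Ici 0) x) (hr : 0 ≤ r.re)
    (hL : Tendsto f atTop (𝓝 L)) (h : r = 0 ∨ L = 0) : f 0 = L := by
  have hx : ∀ x ∈ Ici (0 : ℝ), f 0 = Complex.exp (-(r * (x : ℂ))) * f x := fun x hx => by
    have := eq_exp_mul_of_hasDerivWithinAt (convex_Ici 0) hf hx (self_mem_Ici)
    simpa using this
  rcases h with rfl | rfl
  · refine tendsto_nhds_unique (tendsto_const_nhds.congr' ?_) hL
    filter_upwards [Ici_mem_atTop (0 : ℝ)] with x hx'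
    simpa using hx x hx'
  · refine norm_le_zero_iff.1 (ge_of_tendsto (by simpa using hL.norm) ?_)
    filter_upwards [Ici_mem_atTop (0 : ℝ)] with x hx'
    rw [hx x hx', norm_mul, Complex.norm_exp]
    refine mul_le_of_le_one_left (norm_nonneg _) (Real.exp_le_one_iff.2 ?_)
    simpa using mul_nonneg hr hx'

/-- The integral of a function that is continuous on a closed interval is differentiable there, also
at the end points. -/
theorem hasDerivWithinAt_integral {s : Set ℝ} (hs : s.OrdConnected) (hc : IsClosed s) {f : ℝ → ℂ}
    (hf : ContinuousOn f s) {a x : ℝ} (ha : a ∈ s) (hx : x ∈ s) :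
    HasDerivWithinAt (fun y => ∫ ξ in a..y, f ξ) (f x) s x := by
  obtain ⟨g, hg⟩ := ContinuousMap.exists_restrict_eq hc ⟨s.domRestrict f, hf.domRestrict⟩
  have hgf : ∀ y ∈ s, g y = f y := fun y hy => congrArg (fun k => k ⟨y, hy⟩) hg
  have h := (g.continuous.integral_hasStrictDerivAt a x).hasDerivAt.hasDerivWithinAt (s := s)
  rw [hgf x hx] at h
  refine h.congr_of_mem (fun y hy => ?_) hx
  exact intervalIntegral.integral_congr fun ξ hξ => (hgf ξ (hs.uIcc_subset ha hy hξ)).symm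

theorem exists_bound_of_tendsto {f : ℝ → ℂ} {L : ℂ} (hf : ContinuousOn f (Ici 0))
    (hL : Tendsto f atTop (𝓝 L)) : ∃ B, ∀ x ∈ Ici (0 : ℝ), ‖f x‖ ≤ B := by
  obtain ⟨X, hX⟩ := eventually_atTop.1 (hL.norm.eventually_le_const (lt_add_one ‖L‖))
  obtain ⟨B, hB⟩ := isCompact_Icc.exists_bound_of_continuousOn
    (hf.mono fun y (hy : y ∈ Icc 0 X) => hy.1)
  refine ⟨max B (‖L‖ + 1), fun x hx => ?_⟩
  rcases le_total x X with h | h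
  · exact (hB x ⟨hx, h⟩).trans (le_max_left _ _)
  · exact (hX x h).trans (le_max_right _ _)

/-! ### Volterra equations on the half-line -/

/-- A function given by Duhamel's formula is continuous, and solves `f' = h - κ (f - δ)` when `h` is
continuous. -/
theorem duhamel {s : Set ℝ} (hs : s.OrdConnected) (hc : IsClosed s) {a : ℝ} (ha : a ∈ s)
    {f h : ℝ → ℂ} {κ δ c : ℂ}
    (hint : IntegrableOn (fun ξ : ℝ => Complex.exp (κ * ξ) * h ξ) s)
    (hf : ∀ x ∈ s, f x = δ + Complex.exp (-(κ * (x : ℂ))) *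
      (c + ∫ ξ in a..x, Complex.exp (κ * ξ) * h ξ)) :
    ContinuousOn f s ∧ (ContinuousOn h s →
      ∀ x ∈ s, HasDerivWithinAt f (h x - κ * (f x - δ)) s x) := by
  constructor
  · have hi : Integrable (s.indicator fun ξ : ℝ => Complex.exp (κ * ξ) * h ξ) :=
      (integrable_indicator_iff hs.measurableSet).2 hint
    have h1 := intervalIntegral.continuous_primitive (fun a b => hi.intervalIntegrable
      (a := a) (b := b)) a
    refine ContinuousOn.congr (f := fun x : ℝ => δ + Complex.exp (-(κ * (x : ℂ))) *
      (c + ∫ ξ in a..x, s.indicator (fun ξ : ℝ => Complex.exp (κ * ξ) * h ξ) ξ))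
      (ContinuousOn.add continuousOn_const (ContinuousOn.mul (by fun_prop)
        (h1.continuousOn.const_add c))) fun x hx => ?_
    rw [hf x hx]
    congr 3
    refine intervalIntegral.integral_congr fun ξ hξ => ?_
    rw [indicator_of_mem (hs.uIcc_subset ha hx hξ)]
  · intro hh x hx
    have h1 := hasDerivWithinAt_integral hs hc
      (f := fun ξ : ℝ => Complex.exp (κ * ξ) * h ξ) (by fun_prop) ha hx
    have he : HasDerivAt (fun ξ : ℝ => Complex.exp (-(κ * (ξ : ℂ))))
        (Complex.exp (-(κ * (x : ℂ))) * -(κ * 1)) x :=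
      ((Complex.ofRealCLM.hasDerivAt.const_mul κ).neg).cexp
    have h2 := ((he.hasDerivWithinAt (s := s)).mul (h1.const_add c)).const_add δ
    refine (h2.congr_of_mem (fun y hy => hf y hy) hx).congr_deriv ?_
    have hee : Complex.exp (-(κ * (x : ℂ))) * Complex.exp (κ * x) = 1 := by
      rw [← Complex.exp_add]; simp
    rw [hf x hx]
    linear_combination h x * hee

/-- `f` satisfies the scalar Volterra equation along the contour from infinity, with source `h`,
phase `κ` and value `δ` at infinity. The convergence of the integral is part of the definition. -/
def TailSolves (κ δ : ℂ) (h f : ℝ → ℂ) : Prop :=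
  ∀ x ∈ Ici (0 : ℝ),
    IntegrableOn (fun ξ : ℝ => Complex.exp (-(κ * ((x - ξ : ℝ) : ℂ))) * h ξ) (Ioi x) ∧
    f x = δ - ∫ ξ in Ioi x, Complex.exp (-(κ * ((x - ξ : ℝ) : ℂ))) * h ξ

theorem TailSolves.integrableOn {κ δ : ℂ} {h f : ℝ → ℂ} (H : TailSolves κ δ h f) :
    IntegrableOn (fun ξ : ℝ => Complex.exp (κ * ξ) * h ξ) (Ioi 0) := by
  simpa using (H 0 self_mem_Ici).1

theorem TailSolves.eq {κ δ : ℂ} {h f : ℝ → ℂ} (H : TailSolves κ δ h f) {x : ℝ}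
    (hx : x ∈ Ici (0 : ℝ)) :
    f x = δ - Complex.exp (-(κ * (x : ℂ))) * ∫ ξ in Ioi x, Complex.exp (κ * ξ) * h ξ := by
  rw [(H x hx).2, ← integral_const_mul]
  congr 2 with ξ
  rw [← mul_assoc, ← Complex.exp_add]
  congr 2
  push_cast
  ring

theorem TailSolves.regular {κ δ : ℂ} {h f : ℝ → ℂ} (H : TailSolves κ δ h f) :
    ContinuousOn f (Ici 0) ∧ (ContinuousOn h (Ici 0) →
      ∀ x ∈ Ici (0 : ℝ), HasDerivWithinAt f (h x - κ * (f x - δ)) (Ici 0) x) := by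
  -- The integral over `(x, ∞)` is the one over `(0, ∞)` minus the one over `(0, x)`.
  refine duhamel (c := -∫ ξ in Ioi (0 : ℝ), Complex.exp (κ * ξ) * h ξ) ordConnected_Ici isClosed_Ici
    (self_mem_Ici (a := (0 : ℝ)))
    ((integrableOn_Ici_iff_integrableOn_Ioi (by finiteness)).2 H.integrableOn) fun x hx => ?_
  rw [H.eq hx, ← intervalIntegral.integral_interval_add_Ioi H.integrableOn
    (H.integrableOn.mono_set (Ioi_subset_Ioi hx))]
  ring

/-- A solution of the equation along the contour from infinity tends to `δ`. For `0 ≤ κ.re` the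
prefactor `exp (-κ x)` is bounded and the tail of the convergent integral of `exp (κ ξ) h ξ` tends
to zero; otherwise the kernel is bounded by `1`, and the source has to be integrable. -/
theorem TailSolves.tendsto {κ δ : ℂ} {h f : ℝ → ℂ} (H : TailSolves κ δ h f)
    (hκ : 0 ≤ κ.re ∨ IntegrableOn h (Ioi 0)) : Tendsto f atTop (𝓝 δ) := by
  suffices hd : Tendsto (fun x => f x - δ) atTop (𝓝 0) by simpa using hd.add_const δ
  rcases le_or_gt 0 κ.re with hre | hre
  · refine squeeze_zero_norm' ?_ (tendsto_norm_zero.comp (tendsto_integral_Ioi_zero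
      (f := fun ξ : ℝ => Complex.exp (κ * ξ) * h ξ) (μ := volume) tendsto_id))
    filter_upwards [Ici_mem_atTop (0 : ℝ)] with x hx
    rw [H.eq hx, sub_sub_cancel_left, norm_neg, norm_mul, Complex.norm_exp]
    refine mul_le_of_le_one_left (norm_nonneg _) (Real.exp_le_one_iff.2 ?_)
    simpa using mul_nonneg hre hx
  · have hi := hκ.resolve_left hre.not_ge
    refine squeeze_zero_norm' ?_ (tendsto_integral_Ioi_zero
      (f := fun ξ : ℝ => ‖h ξ‖) (μ := volume) tendsto_id)
    filter_upwards [Ici_mem_atTop (0 : ℝ)] with x hx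
    rw [(H x hx).2, sub_sub_cancel_left, norm_neg]
    refine (norm_integral_le_integral_norm _).trans (setIntegral_mono_on (H x hx).1.norm
      (hi.mono_set (Ioi_subset_Ioi hx)).norm measurableSet_Ioi fun ξ hξ => ?_)
    rw [norm_mul, Complex.norm_exp]
    refine mul_le_of_le_one_left (norm_nonneg _) (Real.exp_le_one_iff.2 ?_)
    have : 0 ≤ -κ.re * (ξ - x) := mul_nonneg (by linarith) (by linarith [mem_Ioi.1 hξ])
    simp only [Complex.neg_re, Complex.mul_re, Complex.ofReal_re, Complex.ofReal_im]
    linarith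

/-- A solution of a damped equation with an integrable source tends to zero. -/
theorem tendsto_zero_of_damped {f h : ℝ → ℂ} {κ : ℂ} (hκ : 0 < κ.re)
    (hf : ∀ x ∈ Ici (0 : ℝ), HasDerivWithinAt f (h x - κ * f x) (Ici 0) x)
    (hh : ContinuousOn h (Ici 0)) (hi : IntegrableOn h (Ioi 0)) : Tendsto f atTop (𝓝 0) := by
  have hexp : ∀ c : ℝ, Tendsto (fun x : ℝ => Complex.exp (-(κ * ((x - c : ℝ) : ℂ)))) atTop
      (𝓝 0) := fun c => by
    rw [tendsto_zero_iff_norm_tendsto_zero]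
    simp only [Complex.norm_exp]
    refine Real.tendsto_exp_atBot.comp ?_
    simp only [Complex.neg_re, Complex.re_mul_ofReal]
    exact tendsto_neg_atTop_atBot.comp
      ((tendsto_atTop_add_const_right atTop (-c) tendsto_id).const_mul_atTop hκ)
  have hrep : ∀ x ∈ Ici (0 : ℝ), f x = Complex.exp (-(κ * ((x - 0 : ℝ) : ℂ))) * f 0 +
      ∫ ξ in Ioi 0, (Iio x).indicator
        (fun ξ : ℝ => Complex.exp (-(κ * ((x - ξ : ℝ) : ℂ))) * h ξ) ξ := by
    intro x hx
    have hx0 : (0 : ℝ) ≤ x := hx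
    have hd : ∀ y ∈ Ici (0 : ℝ), HasDerivWithinAt
        (fun ξ : ℝ => Complex.exp (-(κ * ((x - ξ : ℝ) : ℂ))) * f ξ)
        (Complex.exp (-(κ * ((x - y : ℝ) : ℂ))) * h y) (Ici 0) y := by
      intro y hy
      have he : HasDerivAt (fun ξ : ℝ => Complex.exp (-(κ * ((x - ξ : ℝ) : ℂ))))
          (Complex.exp (-(κ * ((x - y : ℝ) : ℂ))) * -(κ * ((-1 : ℝ) : ℂ))) y :=
        ((((hasDerivAt_id y).const_sub x).ofReal_comp.const_mul κ).neg).cexp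
      refine (he.hasDerivWithinAt.mul (hf y hy)).congr_deriv ?_
      push_cast
      ring
    have hFTC := intervalIntegral.integral_eq_sub_of_hasDerivAt_of_le hx0
      (fun y hy => ((hd y hy.1).continuousWithinAt.mono fun z (hz : z ∈ Icc 0 x) => hz.1))
      (fun y hy => (hd y hy.1.le).hasDerivAt (Ici_mem_nhds hy.1))
      (ContinuousOn.intervalIntegrable_of_Icc hx0 (by
        have := hh.mono fun z (hz : z ∈ Icc 0 x) => hz.1
        fun_prop))
    rw [setIntegral_indicator measurableSet_Iio, Ioi_inter_Iio, ← integral_Ioc_eq_integral_Ioo,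
      ← intervalIntegral.integral_of_le hx0, hFTC]
    simp
  -- The kernel is bounded by `1` and tends to zero pointwise, and the source dominates.
  have hlim : Tendsto (fun x : ℝ => ∫ ξ in Ioi 0, (Iio x).indicator
      (fun ξ : ℝ => Complex.exp (-(κ * ((x - ξ : ℝ) : ℂ))) * h ξ) ξ) atTop (𝓝 0) := by
    rw [← integral_zero ℝ ℂ (μ := volume.restrict (Ioi 0))]
    refine tendsto_integral_filter_of_dominated_convergence (fun ξ => ‖h ξ‖)
      (.of_forall fun x => ?_) (.of_forall fun x => .of_forall fun ξ => ?_) hi.norm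
      (.of_forall fun ξ => ?_)
    · refine AEStronglyMeasurable.indicator (AEStronglyMeasurable.mul ?_ hi.1) measurableSet_Iio
      exact Continuous.aestronglyMeasurable (by fun_prop)
    · by_cases hξ : ξ ∈ Iio x
      · rw [indicator_of_mem hξ, norm_mul, Complex.norm_exp]
        refine mul_le_of_le_one_left (norm_nonneg _) (Real.exp_le_one_iff.2 ?_)
        rw [Complex.neg_re, Complex.re_mul_ofReal, neg_nonpos]
        exact mul_nonneg hκ.le (sub_nonneg.2 (mem_Iio.1 hξ).le)
      · rw [indicator_of_notMem hξ, norm_zero]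
        exact norm_nonneg _
    · have := (hexp ξ).mul_const (h ξ)
      rw [zero_mul] at this
      refine this.congr' ?_
      filter_upwards [Ioi_mem_atTop ξ] with x hx
      rw [indicator_of_mem (mem_Iio.2 hx)]
  have h0 := ((hexp 0).mul_const (f 0)).add hlim
  rw [zero_mul, zero_add] at h0
  refine h0.congr' ?_
  filter_upwards [Ici_mem_atTop (0 : ℝ)] with x hx using (hrep x hx).symm

/-! ### Columns normalized at infinity -/

/-- `Λ` has only two eigenvalues. -/
theorem lamDiag_eq_of_ne {i j l : Fin 3} (hij : lamDiag i ≠ lamDiag j)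
    (hil : lamDiag i ≠ lamDiag l) : lamDiag l = lamDiag j := by
  revert hij hil
  fin_cases i <;> fin_cases j <;> fin_cases l <;> simp [lamDiag]

/-- A coefficient matrix on the half-line that is continuous, integrable, and off-diagonal with
respect to the eigenspaces of `Λ`. -/
structure IsHalfLinePotential (C : ℝ → Mat3) : Prop where
  continuousOn : ∀ i l, ContinuousOn (fun x => C x i l) (Ici 0)
  integrableOn : ∀ i l, IntegrableOn (fun x => C x i l) (Ioi 0)
  eq_zero : ∀ x i l, lamDiag i = lamDiag l → C x i l = 0

theorem IsHalfLinePotential.neg_transpose {C : ℝ → Mat3} (hC : IsHalfLinePotential C) :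
    IsHalfLinePotential (fun x => -(C x)ᵀ) where
  continuousOn i l := (hC.continuousOn l i).neg
  integrableOn i l := (hC.integrableOn l i).neg
  eq_zero x i l h := by simp [hC.eq_zero x l i h.symm]

theorem IsHalfLinePotential.trace {C : ℝ → Mat3} (hC : IsHalfLinePotential C) (x : ℝ) :
    (C x).trace = 0 := by
  simp [Matrix.trace, hC.eq_zero x _ _ rfl]

theorem IsHalfLinePotential.continuousOn_mulVec {C : ℝ → Mat3} (hC : IsHalfLinePotential C)
    {w : ℝ → Fin 3 → ℂ} (hw : ∀ i, ContinuousOn (fun x => w x i) (Ici 0)) (i : Fin 3) :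
    ContinuousOn (fun x => (C x *ᵥ w x) i) (Ici 0) := by
  simp only [Matrix.mulVec, dotProduct]
  exact continuousOn_finsetSum _ fun l _ => (hC.continuousOn i l).mul (hw l)

/-- The sources of the entries outside the diagonal block are integrable as soon as the entries in
the diagonal block converge. -/
theorem IsHalfLinePotential.integrableOn_mulVec {C : ℝ → Mat3} (hC : IsHalfLinePotential C)
    {w : ℝ → Fin 3 → ℂ} {L : Fin 3 → ℂ} {i j : Fin 3}
    (hw : ∀ i, ContinuousOn (fun x => w x i) (Ici 0))
    (hL : ∀ l, lamDiag l = lamDiag j → Tendsto (fun x => w x l) atTop (𝓝 (L l)))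
    (hij : lamDiag i ≠ lamDiag j) : IntegrableOn (fun x => (C x *ᵥ w x) i) (Ioi 0) := by
  simp only [Matrix.mulVec, dotProduct]
  refine integrable_finsetSum _ fun l _ => ?_
  by_cases hl : lamDiag i = lamDiag l
  · simp [hC.eq_zero _ i l hl]
  · obtain ⟨B, hB⟩ := exists_bound_of_tendsto (hw l) (hL l (lamDiag_eq_of_ne hij hl))
    refine (hC.integrableOn i l).mul_bdd (c := B)
      (((hw l).mono Ioi_subset_Ici_self).aestronglyMeasurable measurableSet_Ioi) ?_
    exact (ae_restrict_mem measurableSet_Ioi).mono fun x hx => hB x (Ioi_subset_Ici_self hx)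

/-- The column `w` satisfies the `j`-th column of the integral equation along the contour from
infinity, with coefficient matrix `C` and phase `κ`. -/
def TailColumn (C : ℝ → Mat3) (κ : ℂ) (j : Fin 3) (w : ℝ → Fin 3 → ℂ) : Prop :=
  ∀ i, TailSolves (κ * (lamDiag i - lamDiag j)) ((1 : Mat3) i j) (fun x => (C x *ᵥ w x) i)
    (fun x => w x i)

theorem TailColumn.continuousOn {C : ℝ → Mat3} {κ : ℂ} {j : Fin 3} {w : ℝ → Fin 3 → ℂ}
    (hw : TailColumn C κ j w) (i : Fin 3) : ContinuousOn (fun x => w x i) (Ici 0) :=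
  (hw i).regular.1

theorem TailColumn.columnSolves {C : ℝ → Mat3} {κ : ℂ} {j : Fin 3} {w : ℝ → Fin 3 → ℂ}
    (hC : IsHalfLinePotential C) (hw : TailColumn C κ j w) : ColumnSolves (Ici 0) C κ j w := by
  intro x hx i
  refine ((hw i).regular.2 (hC.continuousOn_mulVec hw.continuousOn i) x hx).congr_deriv ?_
  by_cases h : i = j
  · simp [h]
  · simp [Matrix.one_apply_ne h]

/-- Every column from infinity tends to the corresponding column of the identity, whatever the sign
of its exponentials. -/
theorem TailColumn.tendsto {C : ℝ → Mat3} {κ : ℂ} {j : Fin 3} {w : ℝ → Fin 3 → ℂ}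
    (hC : IsHalfLinePotential C) (hw : TailColumn C κ j w) (i : Fin 3) :
    Tendsto (fun x => w x i) atTop (𝓝 ((1 : Mat3) i j)) := by
  have hd : ∀ l, lamDiag l = lamDiag j → Tendsto (fun x => w x l) atTop (𝓝 ((1 : Mat3) l j)) :=
    fun l hl => (hw l).tendsto (.inl (by simp [hl]))
  by_cases h : lamDiag i = lamDiag j
  · exact hd i h
  · exact (hw i).tendsto (.inr (hC.integrableOn_mulVec hw.continuousOn hd h))

/-- Two column solutions that agree at some point agree at the origin. -/
theorem ColumnSolves.eq_at_zero_of_eq {C : ℝ → Mat3} {κ : ℂ} {j : Fin 3} {w z : ℝ → Fin 3 → ℂ}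
    (hC : IsHalfLinePotential C) (hw : ColumnSolves (Ici 0) C κ j w)
    (hz : ColumnSolves (Ici 0) C κ j z) {X : ℝ} (hX : 0 ≤ X) (h : w X = z X) : w 0 = z 0 := by
  have hb : ∀ i l, ∃ B, ∀ x ∈ Icc 0 X, ‖C x i l‖ ≤ B := fun i l =>
    isCompact_Icc.exists_bound_of_continuousOn
      ((hC.continuousOn i l).mono fun x (hx : x ∈ Icc 0 X) => hx.1)
  choose B hB using hb
  -- The sum over the rows is a crude Lipschitz constant for the sup norm.
  have hK : ∀ x ∈ Ioc 0 X, LipschitzOnWith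
      (∑ i, ((∑ l, B i l) + ‖κ * (lamDiag i - lamDiag j)‖)).toNNReal
      (fun y : Fin 3 → ℂ => fun i => (C x *ᵥ y) i - κ * (lamDiag i - lamDiag j) * y i) univ := by
    intro x hx
    have hx' : x ∈ Icc 0 X := ⟨hx.1.le, hx.2⟩
    have hnn : ∀ i, 0 ≤ (∑ l, B i l) + ‖κ * (lamDiag i - lamDiag j)‖ := fun i =>
      add_nonneg (Finset.sum_nonneg fun l _ => (norm_nonneg _).trans (hB i l x hx'))
        (norm_nonneg _)
    refine LipschitzOnWith.of_dist_le_mul fun y _ y' _ => ?_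
    rw [Real.coe_toNNReal _ (Finset.sum_nonneg fun i _ => hnn i), dist_eq_norm, dist_eq_norm]
    refine (pi_norm_le_iff_of_nonneg (mul_nonneg (Finset.sum_nonneg fun i _ => hnn i)
      (norm_nonneg _))).2 fun i => ?_
    have e : ((fun i => (C x *ᵥ y) i - κ * (lamDiag i - lamDiag j) * y i) -
        fun i => (C x *ᵥ y') i - κ * (lamDiag i - lamDiag j) * y' i) i =
        (∑ l, C x i l * (y - y') l) - κ * (lamDiag i - lamDiag j) * (y - y') i := by
      simp only [Pi.sub_apply, Matrix.mulVec, dotProduct, mul_sub, Finset.sum_sub_distrib]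
      ring
    rw [e]
    calc _ ≤ ((∑ l, B i l) + ‖κ * (lamDiag i - lamDiag j)‖) * ‖y - y'‖ := by
          rw [add_mul, Finset.sum_mul]
          refine (norm_sub_le _ _).trans (add_le_add ?_ ?_)
          · refine (norm_sum_le _ _).trans (Finset.sum_le_sum fun l _ => ?_)
            rw [norm_mul]
            exact mul_le_mul (hB i l x hx') (norm_le_pi_norm _ l) (norm_nonneg _)
              ((norm_nonneg _).trans (hB i l x hx'))
          · rw [norm_mul]
            exact mul_le_mul_of_nonneg_left (norm_le_pi_norm _ i) (norm_nonneg _)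
      _ ≤ _ := mul_le_mul_of_nonneg_right
          (Finset.single_le_sum (fun i _ => hnn i) (Finset.mem_univ i)) (norm_nonneg _)
  have hc : ∀ {f : ℝ → Fin 3 → ℂ}, ColumnSolves (Ici 0) C κ j f → ContinuousOn f (Icc 0 X) :=
    fun hf => continuousOn_pi.2 fun i x hx =>
      ((hf x hx.1 i).continuousWithinAt).mono fun y (hy : y ∈ Icc 0 X) => hy.1
  have hd : ∀ {f : ℝ → Fin 3 → ℂ}, ColumnSolves (Ici 0) C κ j f → ∀ x ∈ Ioc 0 X,
      HasDerivWithinAt f (fun i => (C x *ᵥ f x) i - κ * (lamDiag i - lamDiag j) * f x i)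
        (Iic x) x :=
    fun hf x hx => hasDerivWithinAt_pi.2 fun i =>
      ((hf x hx.1.le i).hasDerivAt (Ici_mem_nhds hx.1)).hasDerivWithinAt
  exact ODE_solution_unique_of_mem_Icc_left hK (hc hw) (hd hw) (fun _ _ => mem_univ _) (hc hz)
    (hd hz) (fun _ _ => mem_univ _) h (left_mem_Icc.2 hX)

theorem ColumnSolves.const_mul {s : Set ℝ} {C : ℝ → Mat3} {κ : ℂ} {j : Fin 3}
    {w : ℝ → Fin 3 → ℂ} (hw : ColumnSolves s C κ j w) (c : ℂ) :
    ColumnSolves s C κ j (fun x => c • w x) := by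
  intro x hx i
  refine ((hw x hx i).const_mul c).congr_deriv ?_
  simp only [Matrix.mulVec_smul, Pi.smul_apply, smul_eq_mul]
  ring

/-- A vector orthogonal to `a` and `b` is parallel to their cross product. -/
theorem mul_crossProduct_eq {A a b : Fin 3 → ℂ} (ha : A ⬝ᵥ a = 0) (hb : A ⬝ᵥ b = 0)
    (p q : Fin 3) : A p * crossProduct a b q = A q * crossProduct a b p := by
  simp only [dotProduct, Fin.sum_univ_three] at ha hb
  simp only [cross_apply]
  fin_cases p <;> fin_cases q <;> simp
  · linear_combination a 2 * hb - b 2 * ha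
  · linear_combination b 1 * ha - a 1 * hb
  · linear_combination b 2 * ha - a 2 * hb
  · linear_combination a 0 * hb - b 0 * ha
  · linear_combination a 1 * hb - b 1 * ha
  · linear_combination b 0 * ha - a 0 * hb

/-- An adjugated column from infinity annihilates the other columns from infinity, so it is a
multiple of their cross product; the factor is `1` by comparison at infinity. -/
theorem TailColumn.eq_cofactor {C : ℝ → Mat3} {κ : ℂ} {j : Fin 3} {W : ℝ → Mat3}
    {A : ℝ → Fin 3 → ℂ} (hC : IsHalfLinePotential C)
    (hA : TailColumn (fun x => -(C x)ᵀ) (-κ) j A)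
    (hW : ∀ a ≠ j, TailColumn C κ a (fun x i => W x i a))
    (hκ : ∀ m, 0 ≤ (κ * (lamDiag m - lamDiag j)).re) (i : Fin 3) :
    A 0 i = cofactor (W 0) i j := by
  have hA' := hA.columnSolves hC.neg_transpose
  have hW' := fun a ha => (hW a ha).columnSolves hC
  have horth : ∀ a ≠ j, ∀ x ∈ Ici (0 : ℝ), A x ⬝ᵥ (fun i => W x i a) = 0 := by
    intro a ha x hx
    have hode := hA'.hasDerivWithinAt_dotProduct (hW' a ha)
    have hlim : Tendsto (fun x => A x ⬝ᵥ (fun i => W x i a)) atTop (𝓝 0) := by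
      have : Tendsto (fun x => ∑ i, A x i * W x i a) atTop
          (𝓝 (∑ i, (1 : Mat3) i j * (1 : Mat3) i a)) := tendsto_finsetSum _ fun i _ =>
        (hA.tendsto hC.neg_transpose i).mul ((hW a ha).tendsto hC i)
      simpa [Matrix.one_apply, ha, ha.symm, dotProduct] using this
    have h0 := eq_of_tendsto_of_hasDerivWithinAt hode (hκ a) hlim (.inr rfl)
    rw [eq_exp_mul_of_hasDerivWithinAt (convex_Ici 0) hode self_mem_Ici hx, h0, mul_zero]
  have hlimN : Tendsto (fun x => cofactor (W x) j j) atTop (𝓝 1) := by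
    have hW0 : ∀ a ≠ j, ∀ i, Tendsto (fun x => W x i a) atTop (𝓝 ((1 : Mat3) i a)) :=
      fun a ha => (hW a ha).tendsto hC
    have h1 : j + 1 ≠ j := by fin_cases j <;> decide
    have h2 : j + 2 ≠ j := by fin_cases j <;> decide
    have h3 := ((hW0 _ h1 (j + 1)).mul (hW0 _ h2 (j + 2))).sub
      ((hW0 _ h1 (j + 2)).mul (hW0 _ h2 (j + 1)))
    have e : ∀ B : Mat3, cofactor B j j =
        B (j + 1) (j + 1) * B (j + 2) (j + 2) - B (j + 2) (j + 1) * B (j + 1) (j + 2) := by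
      intro B
      rw [cofactor_eq_transpose_adjugate, Matrix.adjugate_fin_three]
      fin_cases j <;> simp <;> ring
    simp only [e]
    convert h3 using 2
    fin_cases j <;> simp
  have hlimA := (hA.tendsto hC.neg_transpose j).div hlimN one_ne_zero
  -- Both sides solve the same linear equation and agree at `x`, hence at `0`; `x` is large so that
  -- the diagonal cofactor does not vanish.
  have hconst : ∀ᶠ x in atTop, A 0 i = A x j / cofactor (W x) j j * cofactor (W 0) i j := by
    filter_upwards [hlimN.eventually_ne one_ne_zero, Ici_mem_atTop (0 : ℝ)] with x hx hx0
    have hcof := (ColumnSolves.cofactor_col hW' fun x _ => hC.trace x).const_mul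
      (A x j / cofactor (W x) j j)
    refine congrFun (hA'.eq_at_zero_of_eq hC.neg_transpose hcof hx0 ?_) i
    ext p
    have h1 := mul_crossProduct_eq (horth (j + 1) (by fin_cases j <;> decide) x hx0)
      (horth (j + 2) (by fin_cases j <;> decide) x hx0) p j
    rw [← cofactor_col_eq_crossProduct] at h1
    simp only [Pi.smul_apply, smul_eq_mul]
    field_simp
    exact h1
  refine tendsto_nhds_unique (tendsto_const_nhds.congr' hconst) ?_
  simpa using hlimA.mul_const (cofactor (W 0) i j)

/-! ### The coefficients of the Lax pair -/

theorem expHat_apply (a : ℂ) (B : Mat3) (i j : Fin 3) :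
    expHat a B i j = Complex.exp (a * (lamDiag i - lamDiag j)) * B i j := by
  rw [expHat, Matrix.mul_diagonal, Matrix.diagonal_mul, mul_right_comm, ← Complex.exp_add]
  congr 2
  ring

theorem continuousOn_initial {T : ℝ} (hT : 0 < T) {w : ℝ → ℝ → ℂ}
    (hw : ContDiffOn ℝ 2 (fun p : ℝ × ℝ => w p.1 p.2) (Ici 0 ×ˢ Icc 0 T)) :
    ContinuousOn (fun x => w x 0) (Ici 0) :=
  hw.continuousOn.comp (f := fun x : ℝ => (x, (0 : ℝ))) (by fun_prop)
    fun _ hx => ⟨hx, left_mem_Icc.2 hT.le⟩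

theorem continuousOn_boundary {T : ℝ} {w : ℝ → ℝ → ℂ}
    (hw : ContDiffOn ℝ 2 (fun p : ℝ × ℝ => w p.1 p.2) (Ici 0 ×ˢ Icc 0 T)) :
    ContinuousOn (fun t => w 0 t) (Icc 0 T) :=
  hw.continuousOn.comp (f := fun t : ℝ => ((0 : ℝ), t)) (by fun_prop)
    fun _ ht => ⟨self_mem_Ici, ht⟩

theorem continuousOn_dx_boundary {T : ℝ} (hT : 0 < T) {w : ℝ → ℝ → ℂ}
    (hw : ContDiffOn ℝ 2 (fun p : ℝ × ℝ => w p.1 p.2) (Ici 0 ×ˢ Icc 0 T)) :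
    ContinuousOn (fun t => dx w 0 t) (Icc 0 T) := by
  have hu : UniqueDiffOn ℝ (Ici (0 : ℝ) ×ˢ Icc 0 T) :=
    (uniqueDiffOn_Ici 0).prod (uniqueDiffOn_Icc hT)
  have hc := (hw.continuousOn_fderivWithin hu (by norm_num)).comp
    (f := fun t : ℝ => ((0 : ℝ), t)) (by fun_prop : ContinuousOn _ (Icc 0 T))
    fun t ht => ⟨self_mem_Ici, ht⟩
  refine (hc.clm_apply (continuousOn_const (c := ((1 : ℝ), (0 : ℝ))))).congr fun t ht => ?_
  have h1 : HasDerivWithinAt (fun ξ : ℝ => (ξ, t)) ((1 : ℝ), (0 : ℝ)) (Ici 0) 0 :=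
    ((hasDerivAt_id (0 : ℝ)).prodMk (hasDerivAt_const 0 t)).hasDerivWithinAt
  have hd := (hw.differentiableOn (by norm_num) ((0 : ℝ), t)
    ⟨self_mem_Ici, ht⟩).hasFDerivWithinAt
  -- `dx` is the value of the Fréchet derivative within the strip at the vector `(1, 0)`.
  have hm : MapsTo (fun ξ : ℝ => (ξ, t)) (Ici 0) (Ici (0 : ℝ) ×ˢ Icc 0 T) := fun ξ hξ => ⟨hξ, ht⟩
  exact (HasFDerivWithinAt.comp_hasDerivWithinAt (0 : ℝ) hd h1 hm).derivWithin
    (uniqueDiffOn_Ici 0 0 self_mem_Ici)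

theorem isHalfLinePotential_V1 {T : ℝ} (hT : 0 < T) {u v : ℝ → ℝ → ℂ} (huv : IsSolution T u v)
    (lam : ℂ) : IsHalfLinePotential (fun x => V1 u v lam x 0) := by
  have hstar : ∀ {f : ℝ → ℂ}, IntegrableOn f (Ioi 0) → IntegrableOn (fun x => star (f x)) (Ioi 0) :=
    fun hf => Complex.conjCLE.integrable_comp_iff.2 hf
  have h0 : (0 : ℝ) ∈ Icc 0 T := left_mem_Icc.2 hT.le
  refine ⟨fun i l => ?_, fun i l => ?_, fun x i l h => ?_⟩
  · have hu := continuousOn_initial hT huv.smooth_u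
    have hv := continuousOn_initial hT huv.smooth_v
    have hu' := hu.star
    have hv' := hv.star
    fin_cases i <;> fin_cases l <;> simp [V1, U1] <;> fun_prop
  · have hu := huv.decay_u 0 h0
    have hv := huv.decay_v 0 h0
    fin_cases i <;> fin_cases l <;> simp only [V1, U1] <;>
      first
        | exact hu.const_mul lam
        | exact hv.const_mul lam
        | exact (hstar hu).const_mul lam
        | exact (hstar hv).const_mul lam
        | simp
  · revert h
    fin_cases i <;> fin_cases l <;> norm_num [V1, U1, lamDiag]

theorem continuousOn_V2_boundary {T : ℝ} (hT : 0 < T) {u v : ℝ → ℝ → ℂ}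
    (huv : IsSolution T u v) (lam : ℂ) (i l : Fin 3) :
    ContinuousOn (fun t => V2 u v lam 0 t i l) (Icc 0 T) := by
  have hu := continuousOn_boundary huv.smooth_u
  have hv := continuousOn_boundary huv.smooth_v
  have hu' := hu.star
  have hv' := hv.star
  have hdu := continuousOn_dx_boundary hT huv.smooth_u
  have hdv := continuousOn_dx_boundary hT huv.smooth_v
  have hdu' := hdu.star
  have hdv' := hdv.star
  fin_cases i <;> fin_cases l <;> simp only [V2, U1, U2, U3, upperA, lowerA, rho] <;> simp <;>
    fun_prop

theorem trace_V2 (u v : ℝ → ℝ → ℂ) (lam : ℂ) (x t : ℝ) : (V2 u v lam x t).trace = 0 := by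
  simp [Matrix.trace_fin_three, V2, U1, U2, U3, rho]
  ring

/-! ### The integral equations on the lines `t = 0` and `x = 0` -/

theorem SolvesEntry.tailSolves {T : ℝ} (hT : 0 < T) {u v : ℝ → ℝ → ℂ} {lam : ℂ}
    {μ : ℝ → ℝ → Mat3} {i j : Fin 3} (h : SolvesEntry Contour.three T u v lam μ i j) :
    TailSolves (Complex.I * kk lam * (lamDiag i - lamDiag j)) ((1 : Mat3) i j)
      (fun x => (V1 u v lam x 0 *ᵥ fun l => μ x 0 l j) i) (fun x => μ x 0 i j) := by
  intro x hx
  have h0 := h x hx 0 (left_mem_Icc.2 hT.le)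
  have e : ∀ ξ : ℝ, Complex.exp (-(Complex.I * kk lam * (lamDiag i - lamDiag j) *
      ((x - ξ : ℝ) : ℂ))) * (V1 u v lam ξ 0 *ᵥ fun l => μ ξ 0 l j) i =
      expHat (-(Complex.I * kk lam * ((x - ξ : ℝ) : ℂ)) +
        2 * Complex.I * kk lam ^ 2 * ((0 - 0 : ℝ) : ℂ)) (V1 u v lam ξ 0 * μ ξ 0) i j := by
    intro ξ
    rw [expHat_apply]
    congr 2
    push_cast
    ring
  simp only [e]
  exact ⟨h0.1, by rw [h0.2, sub_eq_add_neg]; rfl⟩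

theorem tailColumn_of_solvesEntry {T : ℝ} (hT : 0 < T) {u v : ℝ → ℝ → ℂ} {lam : ℂ}
    {μ : ℝ → ℝ → Mat3} {j : Fin 3} (h : ∀ i, SolvesEntry Contour.three T u v lam μ i j) :
    TailColumn (fun x => V1 u v lam x 0) (Complex.I * kk lam) j (fun x i => μ x 0 i j) :=
  fun i => (h i).tailSolves hT

theorem tailColumn_of_solvesAdjEntry {T : ℝ} (hT : 0 < T) {u v : ℝ → ℝ → ℂ} {lam : ℂ}
    {μ : ℝ → ℝ → Mat3} {j : Fin 3} (h : ∀ i, SolvesAdjEntry Contour.three T u v lam μ i j) :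
    TailColumn (fun x => -(V1 u v lam x 0)ᵀ) (-(Complex.I * kk lam)) j (fun x i => μ x 0 i j) := by
  intro i x hx
  have h0 := h i x hx 0 (left_mem_Icc.2 hT.le)
  have e : ∀ ξ : ℝ, Complex.exp (-(-(Complex.I * kk lam) * (lamDiag i - lamDiag j) *
      ((x - ξ : ℝ) : ℂ))) * (-(V1 u v lam ξ 0)ᵀ *ᵥ fun l => μ ξ 0 l j) i =
      -expHat (Complex.I * kk lam * ((x - ξ : ℝ) : ℂ) -
        2 * Complex.I * kk lam ^ 2 * ((0 - 0 : ℝ) : ℂ)) ((V1 u v lam ξ 0)ᵀ * μ ξ 0) i j := by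
    intro ξ
    rw [expHat_apply, Matrix.neg_mulVec, Pi.neg_apply, mul_neg]
    congr 3
    push_cast
    ring
  simp only [e]
  refine ⟨h0.1.neg, ?_⟩
  rw [h0.2, integral_neg]
  rfl

theorem SolvesLax.columnSolves_x {T : ℝ} (hT : 0 < T) {u v : ℝ → ℝ → ℂ} {lam : ℂ}
    {M : ℝ → ℝ → Mat3} (hM : SolvesLax T u v lam M) (j : Fin 3) :
    ColumnSolves (Ici 0) (fun x => V1 u v lam x 0) (Complex.I * kk lam) j
      (fun x i => M x 0 i j) := by
  intro x hx i
  refine (hM.x_part x hx 0 (left_mem_Icc.2 hT.le) i j).congr_deriv ?_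
  rw [Matrix.sub_apply, Matrix.smul_apply, Matrix.sub_apply, LamMat, Matrix.diagonal_mul,
    Matrix.mul_diagonal, smul_eq_mul]
  change (V1 u v lam x 0 *ᵥ fun l => M x 0 l j) i - _ = _
  ring

theorem SolvesLax.columnSolves_t {T : ℝ} {u v : ℝ → ℝ → ℂ} {lam : ℂ}
    {M : ℝ → ℝ → Mat3} (hM : SolvesLax T u v lam M) (j : Fin 3) :
    ColumnSolves (Icc 0 T) (fun t => V2 u v lam 0 t) (-(2 * Complex.I * kk lam ^ 2)) j
      (fun t i => M 0 t i j) := by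
  intro t ht i
  refine (hM.t_part 0 self_mem_Ici t ht i j).congr_deriv ?_
  rw [Matrix.add_apply, Matrix.smul_apply, Matrix.sub_apply, LamMat, Matrix.diagonal_mul,
    Matrix.mul_diagonal, smul_eq_mul]
  change (V2 u v lam 0 t *ᵥ fun l => M 0 t l j) i + _ = _
  ring

theorem SolvesEntry.eq_one_of_contour_one {T : ℝ} (hT : 0 < T) {u v : ℝ → ℝ → ℂ} {lam : ℂ}
    {μ : ℝ → ℝ → Mat3} {i j : Fin 3} (h : SolvesEntry Contour.one T u v lam μ i j) :
    μ 0 T i j = (1 : Mat3) i j := by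
  simpa [Contour.formIntegral] using (h 0 self_mem_Ici T (right_mem_Icc.2 hT.le)).2

theorem SolvesEntry.eq_one_of_contour_two {T : ℝ} (hT : 0 < T) {u v : ℝ → ℝ → ℂ} {lam : ℂ}
    {μ : ℝ → ℝ → Mat3} {i j : Fin 3} (h : SolvesEntry Contour.two T u v lam μ i j) :
    μ 0 0 i j = (1 : Mat3) i j := by
  simpa [Contour.formIntegral] using (h 0 self_mem_Ici 0 (left_mem_Icc.2 hT.le)).2

/-- On the boundary `x = 0`, the integral equation along the contour from `(0, T)` implies the
`t`-part of the Lax pair. -/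
theorem columnSolves_of_contour_one {T : ℝ} (hT : 0 < T) {u v : ℝ → ℝ → ℂ}
    (huv : IsSolution T u v) {lam : ℂ} {μ : ℝ → ℝ → Mat3} {j : Fin 3}
    (h : ∀ i, SolvesEntry Contour.one T u v lam μ i j) :
    ColumnSolves (Icc 0 T) (fun t => V2 u v lam 0 t) (-(2 * Complex.I * kk lam ^ 2)) j
      (fun t i => μ 0 t i j) := by
  have hTm : T ∈ Icc 0 T := right_mem_Icc.2 hT.le
  have e : ∀ i, ∀ t τ : ℝ, expHat (-(Complex.I * kk lam * ((0 - 0 : ℝ) : ℂ)) +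
      2 * Complex.I * kk lam ^ 2 * ((t - τ : ℝ) : ℂ)) (V2 u v lam 0 τ * μ 0 τ) i j =
      Complex.exp (-(-(2 * Complex.I * kk lam ^ 2) * (lamDiag i - lamDiag j) * (t : ℂ))) *
      (Complex.exp (-(2 * Complex.I * kk lam ^ 2) * (lamDiag i - lamDiag j) * (τ : ℂ)) *
        (V2 u v lam 0 τ *ᵥ fun l => μ 0 τ l j) i) := by
    intro i t τ
    rw [expHat_apply, ← mul_assoc, ← Complex.exp_add]
    congr 2
    push_cast
    ring
  have hd := fun i => duhamel (f := fun t => μ 0 t i j) (δ := (1 : Mat3) i j) (c := 0)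
    (κ := -(2 * Complex.I * kk lam ^ 2) * (lamDiag i - lamDiag j))
    (h := fun τ => (V2 u v lam 0 τ *ᵥ fun l => μ 0 τ l j) i) ordConnected_Icc isClosed_Icc hTm
    (by
      have h0 := (h i 0 self_mem_Ici 0 (left_mem_Icc.2 hT.le)).1.1
      simp only [e] at h0
      rw [intervalIntegrable_iff, uIoc_comm, uIoc_of_le hT.le,
        ← integrableOn_Icc_iff_integrableOn_Ioc] at h0
      simpa using h0)
    (fun t ht => by
      have h0 := (h i 0 self_mem_Ici t ht).2
      simp only [Contour.formIntegral, e, intervalIntegral.integral_const_mul,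
        intervalIntegral.integral_same, add_zero] at h0
      rw [h0, zero_add])
  intro t ht i
  have hh : ContinuousOn (fun τ => (V2 u v lam 0 τ *ᵥ fun l => μ 0 τ l j) i) (Icc 0 T) := by
    simp only [Matrix.mulVec, dotProduct]
    exact continuousOn_finsetSum _ fun l _ =>
      (continuousOn_V2_boundary hT huv lam i l).mul (hd l).1
  refine ((hd i).2 hh t ht).congr_deriv ?_
  by_cases hij : i = j
  · simp [hij]
  · simp [Matrix.one_apply_ne hij]

/-! ### Wronskians with a matrix solution -/

theorem det_updateCol_eq_sum (B : Mat3) (a : Fin 3) (w : Fin 3 → ℂ) :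
    (B.updateCol a w).det = ∑ i, cofactor B i a * w i := by
  rw [← Matrix.cramer_apply, Matrix.cramer_eq_adjugate_mulVec, cofactor_eq_transpose_adjugate]
  rfl

/-- The Wronskian obtained from a matrix solution `W` by replacing its `a`-th column with a column
solution of label `j`. By Cramer's rule it is a coefficient of `w` in the basis of the columns
of `W`. -/
theorem ColumnSolves.det_updateCol {s : Set ℝ} {C : ℝ → Mat3} {κ : ℂ} {W : ℝ → Mat3}
    {w : ℝ → Fin 3 → ℂ} {a j : Fin 3} (hW : ∀ b, ColumnSolves s C κ b (fun x i => W x i b))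
    (hw : ColumnSolves s C κ j w) (hC : ∀ x ∈ s, (C x).trace = 0) :
    ∀ x ∈ s, HasDerivWithinAt (fun ξ => ((W ξ).updateCol a (w ξ)).det)
      (κ * (lamDiag j - lamDiag a) * ((W x).updateCol a (w x)).det) s x := by
  intro x hx
  refine (ColumnSolves.hasDerivWithinAt_det (κ := κ) (W := fun ξ => (W ξ).updateCol a (w ξ))
    (m := fun b => if b = a then j else b) (fun b => ?_) hC x hx).congr_deriv ?_
  · by_cases hb : b = a
    · subst hb
      simpa using hw
    · simpa [hb] using hW b
  · congr 2
    rw [Fin.sum_univ_three]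
    fin_cases a <;> simp [lamDiag]

/-! ### The eigenfunctions `M_n` and the spectral functions -/

/-- At time `0` the eigenfunction `M_n` tends to the identity as `x → ∞`: the entries along `γ₃` by
their integral equation, and the others because their exponential is damping. -/
theorem IsM.tendsto {T : ℝ} (hT : 0 < T) {u v : ℝ → ℝ → ℂ} (huv : IsSolution T u v) {lam : ℂ}
    {M : ℝ → ℝ → Mat3} (hM : IsM T u v lam M) (i j : Fin 3) :
    Tendsto (fun x => M x 0 i j) atTop (𝓝 ((1 : Mat3) i j)) := by
  have hC := isHalfLinePotential_V1 hT huv lam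
  have hode := hM.lax.columnSolves_x hT j
  have hcont : ∀ i, ContinuousOn (fun x => M x 0 i j) (Ici 0) := fun i x hx =>
    (hode x hx i).continuousWithinAt
  have htail : ∀ i, (ll lam j).re ≤ (ll lam i).re →
      TailSolves (Complex.I * kk lam * (lamDiag i - lamDiag j)) ((1 : Mat3) i j)
        (fun x => (V1 u v lam x 0 *ᵥ fun l => M x 0 l j) i) (fun x => M x 0 i j) := by
    intro i hi
    have := hM.entries i j
    rw [contourOf, if_neg hi.not_gt] at this
    exact this.tailSolves hT
  have hdiag : ∀ l, lamDiag l = lamDiag j →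
      Tendsto (fun x => M x 0 l j) atTop (𝓝 ((1 : Mat3) l j)) := fun l hl =>
    (htail l (by simp [ll, hl])).tendsto (.inl (by simp [hl]))
  by_cases hij : lamDiag i = lamDiag j
  · exact hdiag i hij
  have hint := hC.integrableOn_mulVec (w := fun x l => M x 0 l j) hcont hdiag hij
  rcases le_or_gt (ll lam j).re (ll lam i).re with hl | hl
  · exact (htail i hl).tendsto (.inr hint)
  · have hne : i ≠ j := fun h => hij (by rw [h])
    rw [Matrix.one_apply_ne hne]
    refine tendsto_zero_of_damped (κ := Complex.I * kk lam * (lamDiag i - lamDiag j)) ?_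
      (fun x hx => hode x hx i) (hC.continuousOn_mulVec hcont i) hint
    have : (Complex.I * kk lam * (lamDiag i - lamDiag j)).re = (ll lam j).re - (ll lam i).re := by
      rw [← Complex.sub_re]
      congr 1
      simp only [ll]
      ring
    rw [this]
    linarith

theorem tendsto_det {W : ℝ → Mat3} {L : Mat3}
    (h : ∀ i j, Tendsto (fun x => W x i j) atTop (𝓝 (L i j))) :
    Tendsto (fun x => (W x).det) atTop (𝓝 L.det) :=
  ((continuous_id.matrix_det).tendsto L).comp (tendsto_pi_nhds.2 fun i => tendsto_pi_nhds.2 (h i))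

/-- `det M_n` is constant, as the Lax pair is traceless, and tends to `1`. -/
theorem IsM.det_eq_one {T : ℝ} (hT : 0 < T) {u v : ℝ → ℝ → ℂ} (huv : IsSolution T u v) {lam : ℂ}
    {M : ℝ → ℝ → Mat3} (hM : IsM T u v lam M) :
    (M 0 0).det = 1 := by
  have hC := isHalfLinePotential_V1 hT huv lam
  have hode := ColumnSolves.hasDerivWithinAt_det (W := fun x => M x 0) (m := id)
    (hM.lax.columnSolves_x hT) fun x _ => hC.trace x
  have h0 : Complex.I * kk lam * ((∑ a, lamDiag (id a)) - 1) = 0 := by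
    simp [Fin.sum_univ_three, lamDiag]
  have hlim := tendsto_det (W := fun x => M x 0) (hM.tendsto hT huv)
  rw [Matrix.det_one] at hlim
  exact eq_of_tendsto_of_hasDerivWithinAt hode (by rw [h0]; rfl) hlim (.inl h0)

/-- A column `w` from infinity agrees with the column of `M_n` if none of its Wronskians with the
other columns of `M_n` decays: these Wronskians then vanish, because they tend to zero, and the
remaining coefficient is `1`. -/
theorem IsM.col_eq_of_tailColumn {T : ℝ} (hT : 0 < T) {u v : ℝ → ℝ → ℂ} (huv : IsSolution T u v)
    {lam : ℂ} {M : ℝ → ℝ → Mat3} (hM : IsM T u v lam M)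
    {j : Fin 3} {w : ℝ → Fin 3 → ℂ}
    (hw : TailColumn (fun x => V1 u v lam x 0) (Complex.I * kk lam) j w)
    (hj : ∀ i, 0 ≤ (Complex.I * kk lam * (lamDiag j - lamDiag i)).re) (i : Fin 3) :
    M 0 0 i j = w 0 i := by
  have hC := isHalfLinePotential_V1 hT huv lam
  have hdet : ∀ a, ((M 0 0).updateCol a (w 0)).det = (1 : Mat3) a j := by
    intro a
    have hode := ColumnSolves.det_updateCol (W := fun x => M x 0) (a := a)
      (hM.lax.columnSolves_x hT) (hw.columnSolves hC) fun x _ => hC.trace x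
    have hlim : Tendsto (fun x => ((M x 0).updateCol a (w x)).det) atTop
        (𝓝 ((1 : Mat3) a j)) := by
      have e : ((1 : Mat3).updateCol a fun i => (1 : Mat3) i j).det = (1 : Mat3) a j := by
        rw [← Matrix.cramer_apply, Matrix.cramer_one]
        rfl
      rw [← e]
      refine tendsto_det fun i l => ?_
      simp only [Matrix.updateCol_apply]
      split_ifs
      · exact hw.tendsto hC i
      · exact hM.tendsto hT huv i l
    refine eq_of_tendsto_of_hasDerivWithinAt hode (hj a) hlim ?_
    by_cases h : a = j
    · exact .inl (by simp [h])
    · exact .inr (Matrix.one_apply_ne h)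
  have h := Matrix.mulVec_cramer (M 0 0) (w 0)
  rw [hM.det_eq_one hT huv, one_smul] at h
  rw [← h, show (M 0 0).cramer (w 0) = fun a => (1 : Mat3) a j from
    funext fun a => by rw [Matrix.cramer_apply, hdet a]]
  change _ = (M 0 0 * 1) i j
  rw [mul_one]

/-- The columns of the adjugated eigenfunction are columns of cofactors of `M_n`. -/
theorem IsM.cofactor_eq_of_tailColumn {T : ℝ} (hT : 0 < T) {u v : ℝ → ℝ → ℂ}
    (huv : IsSolution T u v) {lam : ℂ} {M : ℝ → ℝ → Mat3} (hM : IsM T u v lam M)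
    {j : Fin 3} {A : ℝ → Fin 3 → ℂ}
    (hA : TailColumn (fun x => -(V1 u v lam x 0)ᵀ) (-(Complex.I * kk lam)) j A)
    (hj : ∀ m, 0 ≤ (Complex.I * kk lam * (lamDiag m - lamDiag j)).re) (i : Fin 3) :
    A 0 i = cofactor (M 0 0) i j := by
  have hC := isHalfLinePotential_V1 hT huv lam
  have hpair : ∀ m, A 0 ⬝ᵥ (fun i => M 0 0 i m) = (1 : Mat3) j m := by
    intro m
    have hode := (hA.columnSolves hC.neg_transpose).hasDerivWithinAt_dotProduct
      (hM.lax.columnSolves_x hT m)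
    have hlim : Tendsto (fun x => A x ⬝ᵥ (fun i => M x 0 i m)) atTop (𝓝 ((1 : Mat3) j m)) := by
      have : Tendsto (fun x => ∑ i, A x i * M x 0 i m) atTop
          (𝓝 (∑ i, (1 : Mat3) i j * (1 : Mat3) i m)) := tendsto_finsetSum _ fun i _ =>
        (hA.tendsto hC.neg_transpose i).mul (hM.tendsto hT huv i m)
      simpa [Matrix.one_apply, dotProduct, eq_comm] using this
    refine eq_of_tendsto_of_hasDerivWithinAt hode (hj m) hlim ?_
    by_cases h : j = m
    · exact .inl (by simp [h])
    · exact .inr (Matrix.one_apply_ne h)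
  have h1 : A 0 ᵥ* M 0 0 = Pi.single j 1 := by
    ext m
    refine (hpair m).trans ?_
    rw [Matrix.one_apply, Pi.single_apply]
    simp only [eq_comm]
  have h2 := congrArg (fun y => y ᵥ* (M 0 0).adjugate) h1
  simp only [Matrix.vecMul_vecMul, Matrix.mul_adjugate, hM.det_eq_one hT huv, one_smul,
    Matrix.vecMul_one, Matrix.single_one_vecMul] at h2
  rw [h2, cofactor_eq_transpose_adjugate]
  rfl

theorem det_eq_one_of_contour_one {T : ℝ} (hT : 0 < T) {u v : ℝ → ℝ → ℂ}
    (huv : IsSolution T u v) {lam : ℂ} {μ : ℝ → ℝ → Mat3}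
    (h : ∀ i j, SolvesEntry Contour.one T u v lam μ i j) : (μ 0 0).det = 1 := by
  have hode := ColumnSolves.hasDerivWithinAt_det (W := fun t => μ 0 t) (m := id)
    (fun j => columnSolves_of_contour_one hT huv fun i => h i j) fun t _ => trace_V2 u v lam 0 t
  rw [eq_exp_mul_of_hasDerivWithinAt (convex_Icc 0 T) hode (right_mem_Icc.2 hT.le)
    (left_mem_Icc.2 hT.le), show μ 0 T = 1 from
      Matrix.ext fun i j => (h i j).eq_one_of_contour_one hT]
  simp [Fin.sum_univ_three, lamDiag]

/-- An entry of `M_n` that vanishes at `(0, T)` gives a linear relation between `S` and `M_n(0,0)`,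
transported along the boundary `x = 0` by a determinant. -/
theorem det_updateCol_eq_zero {T : ℝ} (hT : 0 < T) {u v : ℝ → ℝ → ℂ}
    (huv : IsSolution T u v) {lam : ℂ} {μ M : ℝ → ℝ → Mat3}
    (h : ∀ i j, SolvesEntry Contour.one T u v lam μ i j) (hM : SolvesLax T u v lam M)
    {a j : Fin 3} (h0 : M 0 T a j = 0) :
    ((μ 0 0).updateCol a fun i => M 0 0 i j).det = 0 := by
  have hode := ColumnSolves.det_updateCol (W := fun t => μ 0 t) (a := a)
    (fun j => columnSolves_of_contour_one hT huv fun i => h i j) (hM.columnSolves_t j)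
    fun t _ => trace_V2 u v lam 0 t
  rw [eq_exp_mul_of_hasDerivWithinAt (convex_Icc 0 T) hode (right_mem_Icc.2 hT.le)
    (left_mem_Icc.2 hT.le), show μ 0 T = 1 from
      Matrix.ext fun i j => (h i j).eq_one_of_contour_one hT, ← Matrix.cramer_apply,
    Matrix.cramer_one]
  simp [h0]

/-! ### Signs of the phases in the sets `D_n` -/

theorem re_phase_neg {lam : ℂ} (h : (ll lam 0).re < (ll lam 1).re) :
    (Complex.I * kk lam).re < 0 := by
  simp only [ll, lamDiag, Matrix.cons_val_zero, Matrix.cons_val_one, mul_neg, mul_one, neg_neg,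
    Complex.neg_re] at h
  linarith

theorem re_phase_pos {lam : ℂ} (h : (ll lam 0).re > (ll lam 1).re) :
    0 < (Complex.I * kk lam).re := by
  simp only [ll, lamDiag, Matrix.cons_val_zero, Matrix.cons_val_one, mul_neg, mul_one, neg_neg,
    Complex.neg_re] at h
  linarith

theorem re_lt_of_mem_union {lam : ℂ} (h : lam ∈ D1 ∪ D2) : (ll lam 0).re < (ll lam 1).re := by
  rcases h with h | h <;> exact h.1

theorem re_gt_of_mem_union {lam : ℂ} (h : lam ∈ D3 ∪ D4) : (ll lam 0).re > (ll lam 1).re := by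
  rcases h with h | h <;> exact h.1

theorem re_phase_of_mem_mu3Domain {lam : ℂ} {j : Fin 3} (h : lam ∈ mu3Domain j) (i : Fin 3) :
    0 ≤ (Complex.I * kk lam * (lamDiag j - lamDiag i)).re := by
  fin_cases j
  all_goals
    first
      | have := re_phase_neg (re_lt_of_mem_union h)
      | have := re_phase_pos (re_gt_of_mem_union h)
    generalize Complex.I * kk lam = c at this
    fin_cases i <;> norm_num [lamDiag] <;> linarith

theorem re_phase_of_mem_mu3AdjDomain {lam : ℂ} {j : Fin 3} (h : lam ∈ mu3AdjDomain j)
    (i : Fin 3) : 0 ≤ (Complex.I * kk lam * (lamDiag i - lamDiag j)).re := by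
  fin_cases j
  all_goals
    first
      | have := re_phase_neg (re_lt_of_mem_union h)
      | have := re_phase_pos (re_gt_of_mem_union h)
    generalize Complex.I * kk lam = c at this
    fin_cases i <;> norm_num [lamDiag] <;> linarith

/-! ### The algebra of the four formulas -/

theorem minor_eq (B : Mat3) (i j : Fin 3) :
    minor B i j = (-1) ^ ((i : ℕ) + (j : ℕ)) * cofactor B i j := by
  simp [cofactor, ← mul_assoc, ← pow_add, ← two_mul]

theorem det_eq_sum_cofactor (B : Mat3) : B.det = ∑ i, cofactor B i 0 * B i 0 := by
  rw [← det_updateCol_eq_sum B 0, show (fun i => B i 0) = B.col 0 from rfl]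
  congr 1
  ext i j
  by_cases h : j = 0
  · subst h; simp
  · simp [h]

/-- With `m_i` the columns of `M` and `n` the first column of cofactors of `S`, the formula is
`(m₀ × m_j) × n = (n · m₀) m_j - (n · m_j) m₀`, where `n · m_j = 0` for `j = 1, 2`. -/
theorem eq_formula1 {M s sA S : Mat3} (hM : M.det = 1) (hS : S.det = 1)
    (h0 : ∀ i, M i 0 = s i 0) (hA1 : ∀ i, sA i 1 = cofactor M i 1)
    (hA2 : ∀ i, sA i 2 = cofactor M i 2)
    (h1 : (S.updateCol 0 fun i => M i 1).det = 0) (h2 : (S.updateCol 0 fun i => M i 2).det = 0) :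
    den1 s S ≠ 0 ∧ M = formula1 s sA S := by
  have hd : den1 s S = (S.updateCol 0 fun i => M i 0).det := by
    rw [det_updateCol_eq_sum, den1, Matrix.mul_apply]
    refine Finset.sum_congr rfl fun i _ => ?_
    rw [h0, Matrix.transpose_apply, mul_comm]
  -- Otherwise `adj S * M` has a zero row, although its determinant is `1`.
  have hne : den1 s S ≠ 0 := by
    intro h
    have hrow : (S.adjugate * M).det = 0 := by
      refine Matrix.det_eq_zero_of_row_eq_zero 0 fun j => ?_
      have e : (S.adjugate * M) 0 j = (S.updateCol 0 fun i => M i j).det := by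
        rw [← Matrix.cramer_apply, Matrix.cramer_eq_adjugate_mulVec]
        rfl
      rw [e]
      fin_cases j
      · exact hd.symm.trans h
      · exact h1
      · exact h2
    rw [Matrix.det_mul, Matrix.det_adjugate, hM, hS] at hrow
    simp at hrow
  refine ⟨hne, ?_⟩
  rw [det_updateCol_eq_sum, Fin.sum_univ_three] at h1 h2
  have hd' : den1 s S =
      cofactor S 0 0 * M 0 0 + cofactor S 1 0 * M 1 0 + cofactor S 2 0 * M 2 0 := by
    rw [hd, det_updateCol_eq_sum, Fin.sum_univ_three]
  have hA : ∀ i, (sA i 1 = M.adjugate 1 i) ∧ sA i 2 = M.adjugate 2 i := fun i => by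
    rw [hA1, hA2, cofactor_eq_transpose_adjugate]
    exact ⟨rfl, rfl⟩
  simp only [Matrix.adjugate_fin_three] at hA
  ext i j
  fin_cases j
  · refine (h0 i).trans ?_
    fin_cases i <;> rfl
  all_goals
    fin_cases i <;>
    simp [formula1, minor_eq, minorOfCofactor, hA] <;>
    rw [eq_div_iff hne, hd']
  · linear_combination M 0 0 * h1
  · linear_combination M 1 0 * h1
  · linear_combination M 2 0 * h1
  · linear_combination M 0 0 * h2
  · linear_combination M 1 0 * h2
  · linear_combination M 2 0 * h2

theorem eq_formula2 {M s sA : Mat3} (hM : M.det = 1)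
    (h0 : ∀ i, M i 0 = s i 0) (hA1 : ∀ i, sA i 1 = cofactor M i 1)
    (hA2 : ∀ i, sA i 2 = cofactor M i 2) (h1 : M 0 1 = 0) (h2 : M 0 2 = 0) :
    s 0 0 ≠ 0 ∧ M = formula2 s sA := by
  have hne : s 0 0 ≠ 0 := by
    intro h
    rw [Matrix.det_fin_three, h0 0, h, h1, h2] at hM
    simp at hM
  refine ⟨hne, ?_⟩
  have hA : ∀ i, (sA i 1 = M.adjugate 1 i) ∧ sA i 2 = M.adjugate 2 i := fun i => by
    rw [hA1, hA2, cofactor_eq_transpose_adjugate]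
    exact ⟨rfl, rfl⟩
  simp only [Matrix.adjugate_fin_three] at hA
  ext i j
  fin_cases j
  · refine (h0 i).trans ?_
    fin_cases i <;> rfl
  all_goals
    fin_cases i <;> simp [formula2, minorOfCofactor, hA, h1, h2, h0 0] <;> field_simp

/-- The common case of the third and fourth formulas: the first column of `M` is a multiple of a
given vector `w`, and the factor is fixed by `det M = 1`. -/
theorem col_eq_div {M : Mat3} {sA w : Fin 3 → ℂ} {c : ℂ} (hM : M.det = 1)
    (hA : ∀ i, sA i = cofactor M i 0) (hw : ∀ i, M i 0 = c * w i) :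
    ∑ i, w i * sA i ≠ 0 ∧ ∀ i, M i 0 = w i / ∑ i, w i * sA i := by
  have h : c * ∑ i, w i * sA i = 1 := by
    rw [← hM, det_eq_sum_cofactor, Finset.mul_sum]
    refine Finset.sum_congr rfl fun i _ => ?_
    rw [hA, hw]
    ring
  have hne : ∑ i, w i * sA i ≠ 0 := fun h0 => by simp [h0] at h
  refine ⟨hne, fun i => ?_⟩
  rw [hw, eq_div_iff hne, mul_right_comm, h, one_mul]

theorem eq_formula3 {M s sA : Mat3} (hM : M.det = 1)
    (hs1 : ∀ i, M i 1 = s i 1) (hs2 : ∀ i, M i 2 = s i 2) (hA : ∀ i, sA i 0 = cofactor M i 0)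
    (h1 : M 1 0 = 0) (h2 : M 2 0 = 0) :
    minorOfCofactor sA 0 0 ≠ 0 ∧ M = formula3 s sA := by
  have h := col_eq_div (w := ![1, 0, 0]) (c := M 0 0) hM hA
    (fun i => by fin_cases i <;> simp [h1, h2])
  have e : ∑ i, (![1, 0, 0] : Fin 3 → ℂ) i * sA i 0 = minorOfCofactor sA 0 0 := by
    simp [Fin.sum_univ_three, minorOfCofactor]
  rw [e] at h
  refine ⟨h.1, ?_⟩
  ext i j
  fin_cases j
  · refine (h.2 i).trans ?_
    fin_cases i <;> simp [formula3]
  · refine (hs1 i).trans ?_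
    fin_cases i <;> rfl
  · refine (hs2 i).trans ?_
    fin_cases i <;> rfl

theorem eq_formula4 {M s sA S : Mat3} (hM : M.det = 1) (hS : S.det = 1)
    (hs1 : ∀ i, M i 1 = s i 1) (hs2 : ∀ i, M i 2 = s i 2) (hA : ∀ i, sA i 0 = cofactor M i 0)
    (h1 : (S.updateCol 1 fun i => M i 0).det = 0) (h2 : (S.updateCol 2 fun i => M i 0).det = 0) :
    den4 sA S ≠ 0 ∧ M = formula4 s sA S := by
  have hc := Matrix.mulVec_cramer S (fun i => M i 0)
  rw [hS, one_smul] at hc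
  have h := col_eq_div (w := fun i => S i 0) (c := (S.updateCol 0 fun i => M i 0).det) hM hA
    (fun i => by
      have := congrFun hc i
      simp only [Matrix.mulVec, dotProduct, Fin.sum_univ_three, Matrix.cramer_apply, h1, h2] at this
      linear_combination -this)
  change den4 sA S ≠ 0 ∧ ∀ i, M i 0 = S i 0 / den4 sA S at h
  refine ⟨h.1, ?_⟩
  ext i j
  fin_cases j
  · refine (h.2 i).trans ?_
    fin_cases i <;> rfl
  · refine (hs1 i).trans ?_
    fin_cases i <;> rfl
  · refine (hs2 i).trans ?_
    fin_cases i <;> rfl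

theorem contourOf_eq_one {lam : ℂ} {i j : Fin 3} (hl : (ll lam i).re < (ll lam j).re)
    (hz : (zz lam i).re ≥ (zz lam j).re) : contourOf lam i j = Contour.one := by
  rw [contourOf, if_pos hl, if_pos hz]

theorem contourOf_eq_two {lam : ℂ} {i j : Fin 3} (hl : (ll lam i).re < (ll lam j).re)
    (hz : (zz lam i).re < (zz lam j).re) : contourOf lam i j = Contour.two := by
  rw [contourOf, if_pos hl, if_neg hz.not_ge]

end CMNLS

theorem proposition2p6 (T : ℝ) (hT : 0 < T) (u v : ℝ → ℝ → ℂ) (huv : CMNLS.IsSolution T u v)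
    (μ₁ μ₃ μ₃A : ℝ → ℝ → ℂ → CMNLS.Mat3)
    (hμ₁ : CMNLS.IsMu1 T u v μ₁) (hμ₃ : CMNLS.IsMu3 T u v μ₃)
    (hμ₃A : CMNLS.IsMu3Adj T u v μ₃A)
    (s sA S : ℂ → CMNLS.Mat3)
    (hs : ∀ lam, s lam = μ₃ 0 0 lam) (hsA : ∀ lam, sA lam = μ₃A 0 0 lam)
    (hS : ∀ lam, S lam = μ₁ 0 0 lam) :
    -- the formulas for `S_n(λ) = M_n(0,0,λ)`, at every `λ ∈ D_n` where `M_n` exists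
    (∀ lam ∈ CMNLS.D1, ∀ M : ℝ → ℝ → CMNLS.Mat3, CMNLS.IsM T u v lam M →
      CMNLS.den1 (s lam) (S lam) ≠ 0 ∧
        M 0 0 = CMNLS.formula1 (s lam) (sA lam) (S lam)) ∧
    (∀ lam ∈ CMNLS.D2, ∀ M : ℝ → ℝ → CMNLS.Mat3, CMNLS.IsM T u v lam M →
      s lam 0 0 ≠ 0 ∧ M 0 0 = CMNLS.formula2 (s lam) (sA lam)) ∧
    (∀ lam ∈ CMNLS.D3, ∀ M : ℝ → ℝ → CMNLS.Mat3, CMNLS.IsM T u v lam M →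
      CMNLS.minorOfCofactor (sA lam) 0 0 ≠ 0 ∧
        M 0 0 = CMNLS.formula3 (s lam) (sA lam)) ∧
    (∀ lam ∈ CMNLS.D4, ∀ M : ℝ → ℝ → CMNLS.Mat3, CMNLS.IsM T u v lam M →
      CMNLS.den4 (sA lam) (S lam) ≠ 0 ∧
        M 0 0 = CMNLS.formula4 (s lam) (sA lam) (S lam)) ∧
    -- each column of `sᴬ` consists of the cofactors of `s` whenever the two columns of `s`
    -- from which these cofactors are formed exist
    (∀ j : Fin 3, ∀ lam ∈ CMNLS.mu3AdjDomain j,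
      (∀ j' : Fin 3, j' ≠ j → ∀ i : Fin 3,
        CMNLS.SolvesEntry CMNLS.Contour.three T u v lam (fun x t => μ₃ x t lam) i j') →
      ∀ i : Fin 3, sA lam i j = CMNLS.cofactor (s lam) i j) := by
  have hscol : ∀ j, ∀ lam ∈ CMNLS.mu3Domain j, ∀ M, CMNLS.IsM T u v lam M →
      ∀ i, M 0 0 i j = s lam i j := fun j lam hl M hM i => by
    rw [hs]
    exact hM.col_eq_of_tailColumn hT huv (CMNLS.tailColumn_of_solvesEntry hT (hμ₃ j lam hl))
      (CMNLS.re_phase_of_mem_mu3Domain hl) i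
  have hAcol : ∀ j, ∀ lam ∈ CMNLS.mu3AdjDomain j, ∀ M, CMNLS.IsM T u v lam M →
      ∀ i, sA lam i j = CMNLS.cofactor (M 0 0) i j := fun j lam hl M hM i => by
    rw [hsA]
    exact hM.cofactor_eq_of_tailColumn hT huv
      (CMNLS.tailColumn_of_solvesAdjEntry hT (hμ₃A j lam hl))
      (CMNLS.re_phase_of_mem_mu3AdjDomain hl) i
  have hSdet : ∀ lam, (S lam).det = 1 := fun lam => by
    rw [hS]
    exact CMNLS.det_eq_one_of_contour_one hT huv (hμ₁ lam)
  have hrel : ∀ lam M, CMNLS.IsM T u v lam M → ∀ a j, a ≠ j →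
      (CMNLS.ll lam a).re < (CMNLS.ll lam j).re → (CMNLS.zz lam a).re ≥ (CMNLS.zz lam j).re →
      ((S lam).updateCol a fun i => M 0 0 i j).det = 0 := fun lam M hM a j haj hl hz => by
    rw [hS]
    refine CMNLS.det_updateCol_eq_zero hT huv (hμ₁ lam) hM.lax ?_
    have h := hM.entries a j
    rw [CMNLS.contourOf_eq_one hl hz] at h
    rw [h.eq_one_of_contour_one hT, Matrix.one_apply_ne haj]
  have hzero : ∀ lam M, CMNLS.IsM T u v lam M → ∀ a j, a ≠ j →
      (CMNLS.ll lam a).re < (CMNLS.ll lam j).re → (CMNLS.zz lam a).re < (CMNLS.zz lam j).re →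
      M 0 0 a j = 0 := fun lam M hM a j haj hl hz => by
    have h := hM.entries a j
    rw [CMNLS.contourOf_eq_two hl hz] at h
    rw [h.eq_one_of_contour_two hT, Matrix.one_apply_ne haj]
  refine ⟨fun lam hl M hM => ?_, fun lam hl M hM => ?_, fun lam hl M hM => ?_,
    fun lam hl M hM => ?_, fun j lam hl hcols i => ?_⟩
  · obtain ⟨hl1, hl2, hz1, hz2⟩ := id hl
    exact CMNLS.eq_formula1 (hM.det_eq_one hT huv) (hSdet lam) (hscol 0 lam (.inl hl) M hM)
      (hAcol 1 lam (.inl hl) M hM) (hAcol 2 lam (.inl hl) M hM)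
      (hrel lam M hM 0 1 (by decide) hl1 hz1.le)
      (hrel lam M hM 0 2 (by decide) (hl2 ▸ hl1) (hz2 ▸ hz1.le))
  · obtain ⟨hl1, hl2, hz1, hz2⟩ := id hl
    exact CMNLS.eq_formula2 (hM.det_eq_one hT huv) (hscol 0 lam (.inr hl) M hM)
      (hAcol 1 lam (.inr hl) M hM) (hAcol 2 lam (.inr hl) M hM)
      (hzero lam M hM 0 1 (by decide) hl1 hz1)
      (hzero lam M hM 0 2 (by decide) (hl2 ▸ hl1) (hz2 ▸ hz1))
  · obtain ⟨hl1, hl2, hz1, hz2⟩ := id hl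
    exact CMNLS.eq_formula3 (hM.det_eq_one hT huv) (hscol 1 lam (.inl hl) M hM)
      (hscol 2 lam (.inl hl) M hM) (hAcol 0 lam (.inl hl) M hM)
      (hzero lam M hM 1 0 (by decide) hl1 hz1)
      (hzero lam M hM 2 0 (by decide) (hl2 ▸ hl1) (hz2 ▸ hz1))
  · obtain ⟨hl1, hl2, hz1, hz2⟩ := id hl
    exact CMNLS.eq_formula4 (hM.det_eq_one hT huv) (hSdet lam) (hscol 1 lam (.inr hl) M hM)
      (hscol 2 lam (.inr hl) M hM) (hAcol 0 lam (.inr hl) M hM)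
      (hrel lam M hM 1 0 (by decide) hl1 hz1.le)
      (hrel lam M hM 2 0 (by decide) (hl2 ▸ hl1) (hz2 ▸ hz1.le))
  · rw [hs, hsA]
    have hW : ∀ a ≠ j, CMNLS.TailColumn (fun x => CMNLS.V1 u v lam x 0)
        (Complex.I * CMNLS.kk lam) a (fun x i => μ₃ x 0 lam i a) := fun a ha =>
      CMNLS.tailColumn_of_solvesEntry (μ := fun x t => μ₃ x t lam) hT (hcols a ha)
    exact CMNLS.TailColumn.eq_cofactor (W := fun x => μ₃ x 0 lam)
      (CMNLS.isHalfLinePotential_V1 hT huv lam)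
      (CMNLS.tailColumn_of_solvesAdjEntry hT (hμ₃A j lam hl))
      hW
      (CMNLS.re_phase_of_mem_mu3AdjDomain hl) i
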